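/- Let $(M,\mathcal P)$ be a (smooth, Hausdorff, second countable) Poisson manifold of dimension $d$ and let $2n\le d$. A star-product on $M$ is the $\mathbb C[[\hbar]]$-bilinear extension to $C^\infty(M;\mathbb C)[[\hbar]]$ of $f\star g=\sum_{k\ge0}\hbar^kC_k(f,g)$, where the $C_k$ are (finite order) bidifferential operators on $C^\infty(M;\mathbb C)$, $C_0(f,g)=fg$, $C_1(f,g)-C_1(g,f)=i\{f,g\}$, $\sum_{l=0}^k\bigl(C_l(C_{k-l}(f,g),h)-C_l(f,C_{k-l}(g,h))\bigr)=0$ for all $k$, and $C_k(f,1)=C_k(1,f)=0$ for $k\ge1$. Let $J=(J^{\mu\nu})$ be the $d\times d$ matrix with block rows $(0,I_n,0)$, $(-I_n,0,0)$, $(0,0,0)$. Let $(x^1,\dots,x^d)$ be a coordinate system on an open domain of $M$, with image an open set $U\subset\mathbb R^d$, and denote by $C_k$ also the bidifferential operators on $U$ which represent the $C_k$ in these coordinates, and by $\star$ the resulting product on $C^\infty(U)[[\hbar]]$. Assume that the coordinate system is classical canonical, $\{x^\mu,x^\nu\}=J^{\mu\nu}$, and quantum canonical, $\frac1{i\hbar}(x^\mu\star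 x^\nu-x^\nu\star x^\mu)=J^{\mu\nu}$. Let $\star_M$ be the Moyal product on $C^\infty(U)[[\hbar]]$, i.e. the $\mathbb C[[\hbar]]$-bilinear extension of $$f\star_Mg=\sum_{k\ge0}\frac1{k!}\Bigl(\frac{i\hbar}2\Bigr)^kJ^{\mu_1\nu_1}\cdots J^{\mu_k\nu_k}\,(\partial_{\mu_1}\cdots\partial_{\mu_k}f)(\partial_{\nu_1}\cdots\partial_{\nu_k}g)$$ (summation over repeated indices). Then there is a unique series $S=\mathrm{id}+\sum_{k\ge1}\hbar^kS_k$, where the $S_k$ are (finite order) differential operators on $C^\infty(U)$ extended $\mathbb C[[\hbar]]$-linearly, such that $$S(f\star_Mg)=Sf\star Sg\quad(f,g\in C^\infty(U)[[\hbar]]),\qquad Sx^\alpha=x^\alpha\quad(1\le\alpha\le d).$$ Moreover, with $S_0=\mathrm{id}$, one has $S_k1=0$ for $k\ge1$ and $$[S_k,x^\alpha](f)=\tfrac12\sum_{l=1}^k\bigl(C_l(x^\alpha,S_{k-l}f)+C_l(S_{k-l}f,x^\alpha)\bigr),\qquad k\ge1,\ f\in C^\infty(U),$$ and $S$ is the only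 series of this form (identity plus higher order terms with differential operators as coefficients) which satisfies this recurrence and $S_k1=0$ for all $k\ge1$. -/

import Mathlib

open scoped Manifold ContDiff

noncomputable section

namespace StarProd

/-! ### Smooth complex-valued functions on an open subset of `ℝ^d` -/

/-- `ℝ^d`. -/
abbrev Eucl (d : ℕ) : Type := EuclideanSpace ℝ (Fin d)

/-- Extension by zero of a function on `U ⊆ ℝ^d`. Only its values on `U` are ever used. -/
def ext0 {d : ℕ} {U : TopologicalSpace.Opens (Eucl d)} (f : U → ℂ) : Eucl d → ℂ :=
  Function.extend Subtype.val f 0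

theorem ext0_apply {d : ℕ} {U : TopologicalSpace.Opens (Eucl d)} (f : U → ℂ) (y : U) :
    ext0 f (y : Eucl d) = f y :=
  Subtype.val_injective.extend_apply f 0 y

/-- The `ℂ`-algebra `C^∞(U)` of smooth complex-valued functions on an open `U ⊆ ℝ^d`. -/
def CInf {d : ℕ} (U : TopologicalSpace.Opens (Eucl d)) : Subalgebra ℂ (U → ℂ) where
  carrier := {f | ContDiffOn ℝ ∞ (ext0 f) (U : Set (Eucl d))}
  mul_mem' {f g} hf hg :=
    (ContDiffOn.mul hf hg).congr fun y hy => by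
      simp [ext0_apply (f * g) ⟨y, hy⟩, ext0_apply f ⟨y, hy⟩, ext0_apply g ⟨y, hy⟩]
  add_mem' {f g} hf hg :=
    (ContDiffOn.add hf hg).congr fun y hy => by
      simp [ext0_apply (f + g) ⟨y, hy⟩, ext0_apply f ⟨y, hy⟩, ext0_apply g ⟨y, hy⟩]
  algebraMap_mem' c :=
    (contDiffOn_const (c := c)).congr fun y hy => by
      simp [ext0_apply _ ⟨y, hy⟩]

/-- A smooth function on `ℝ^d` restricts to an element of `C^∞(U)`. -/
theorem mem_CInf_of_contDiffOn {d : ℕ} {U : TopologicalSpace.Opens (Eucl d)} (F : Eucl d → ℂ)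
    (hF : ContDiffOn ℝ ∞ F (U : Set (Eucl d))) : (fun y : U => F y) ∈ CInf U :=
  hF.congr fun y hy => ext0_apply (fun y : U => F y) ⟨y, hy⟩

/-- The coordinate function `x^α` on `U`. -/
def coordFn {d : ℕ} (U : TopologicalSpace.Opens (Eucl d)) (α : Fin d) : CInf U :=
  ⟨fun y => (((y : Eucl d) α : ℝ) : ℂ),
    mem_CInf_of_contDiffOn (fun y => ((y α : ℝ) : ℂ)) (by
      have h1 : ContDiff ℝ ∞ (fun y : Eucl d => y α) :=
        (EuclideanSpace.proj (𝕜 := ℝ) α).contDiff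
      exact (Complex.ofRealCLM.contDiff.comp h1).contDiffOn)⟩

/-- The partial derivative `∂/∂x^i` as a `ℂ`-linear operator on `C^∞(U)`. -/
def pderiv {d : ℕ} (U : TopologicalSpace.Opens (Eucl d)) (i : Fin d) :
    Module.End ℂ (CInf U) where
  toFun f := ⟨fun y => fderiv ℝ (ext0 f.1) y (EuclideanSpace.single i 1),
    mem_CInf_of_contDiffOn
      (fun y => fderiv ℝ (ext0 f.1) y (EuclideanSpace.single i 1))
      ((f.2.fderiv_of_isOpen U.isOpen (by simp)).clm_apply contDiffOn_const)⟩
  map_add' f g := by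
    ext y
    have hf : DifferentiableAt ℝ (ext0 f.1) y :=
      (f.2.contDiffAt (U.isOpen.mem_nhds y.2)).differentiableAt (by simp)
    have hg : DifferentiableAt ℝ (ext0 g.1) y :=
      (g.2.contDiffAt (U.isOpen.mem_nhds y.2)).differentiableAt (by simp)
    have h : ext0 (f + g).1 = ext0 f.1 + ext0 g.1 := by
      have := Function.extend_add (Subtype.val : U → Eucl d) f.1 g.1 (0 : Eucl d → ℂ) 0
      simpa [ext0] using this
    simp only [h]
    rw [fderiv_add hf hg]
    rfl
  map_smul' c f := by
    ext y
    have hf : DifferentiableAt ℝ (ext0 f.1) y :=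
      (f.2.contDiffAt (U.isOpen.mem_nhds y.2)).differentiableAt (by simp)
    have h : ext0 (c • f).1 = c • ext0 f.1 := by
      have := Function.extend_smul c (Subtype.val : U → Eucl d) f.1 (0 : Eucl d → ℂ)
      simpa [ext0] using this
    simp only [h]
    rw [fderiv_const_smul hf]
    rfl

/-- The iterated partial derivative `∂_{w 0} ∂_{w 1} ⋯ ∂_{w (r-1)}`. -/
def pderivWord {d : ℕ} (U : TopologicalSpace.Opens (Eucl d)) {r : ℕ} (w : Fin r → Fin d) :
    Module.End ℂ (CInf U) :=
  (List.ofFn fun j => pderiv U (w j)).prod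

/-- The partial derivative `∂^I = ∏ i, (∂_i)^(I i)` attached to a multi-index `I`. -/
def pderivMulti {d : ℕ} (U : TopologicalSpace.Opens (Eucl d)) (I : Fin d → ℕ) :
    Module.End ℂ (CInf U) :=
  (List.ofFn fun i => pderiv U i ^ I i).prod

/-- `ℂ`-bilinear operators on a `ℂ`-module. -/
abbrev Bilin (A : Type*) [AddCommGroup A] [Module ℂ A] : Type _ := A →ₗ[ℂ] A →ₗ[ℂ] A

/-- `D` is a (finite order) differential operator on `U`: `D f = ∑ I, c_I ∂^I f`, a finite sum
with coefficients in `C^∞(U)`. -/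
def IsDiffOp {d : ℕ} {U : TopologicalSpace.Opens (Eucl d)} (D : Module.End ℂ (CInf U)) : Prop :=
  ∃ (s : Finset (Fin d → ℕ)) (c : (Fin d → ℕ) → CInf U),
    ∀ f, D f = ∑ I ∈ s, c I * pderivMulti U I f

/-- `B` is a (finite order) bidifferential operator on `U`:
`B(f, g) = ∑ I J, c_{I,J} ∂^I f ∂^J g`, a finite sum with coefficients in `C^∞(U)`. -/
def IsBidiffOp {d : ℕ} {U : TopologicalSpace.Opens (Eucl d)} (B : Bilin (CInf U)) : Prop :=
  ∃ (s : Finset ((Fin d → ℕ) × (Fin d → ℕ))) (c : (Fin d → ℕ) × (Fin d → ℕ) → CInf U),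
    ∀ f g, B f g = ∑ IJ ∈ s, c IJ * (pderivMulti U IJ.1 f * pderivMulti U IJ.2 g)

/-! ### Formal power series in `ħ` -/

/-- The `ℂ⟦ħ⟧`-bilinear extension to `A⟦ħ⟧` of `(f, g) ↦ ∑ k, ħ^k C_k(f, g)`. -/
def formalProduct {A : Type*} [CommRing A] [Algebra ℂ A] (C : ℕ → Bilin A)
    (f g : PowerSeries A) : PowerSeries A :=
  PowerSeries.mk fun m =>
    ∑ a ∈ Finset.HasAntidiagonal.antidiagonal m, ∑ b ∈ Finset.HasAntidiagonal.antidiagonal a.2,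
      C a.1 (PowerSeries.coeff b.1 f) (PowerSeries.coeff b.2 g)

/-- The `ℂ⟦ħ⟧`-linear operator `∑ k, ħ^k S_k` on `A⟦ħ⟧`. -/
def formalOperator {A : Type*} [CommRing A] [Algebra ℂ A] (S : ℕ → Module.End ℂ A)
    (f : PowerSeries A) : PowerSeries A :=
  PowerSeries.mk fun m =>
    ∑ a ∈ Finset.HasAntidiagonal.antidiagonal m, S a.1 (PowerSeries.coeff a.2 f)

/-- The deformed Poisson bracket `(1/(iħ)) (f ⋆ g - g ⋆ f)` of the product with coefficients
`C_k`. (The division by `ħ` shifts coefficients; the commutator has no constant term as soon as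
`C_0` is commutative.) -/
def deformedBracket {A : Type*} [CommRing A] [Algebra ℂ A] (C : ℕ → Bilin A)
    (f g : PowerSeries A) : PowerSeries A :=
  PowerSeries.mk fun m =>
    (1 / Complex.I) • PowerSeries.coeff (m + 1) (formalProduct C f g - formalProduct C g f)

/-! ### The canonical Poisson tensor and the Moyal product -/

/-- The `d × d` matrix with block rows `(0, I_n, 0)`, `(-I_n, 0, 0)`, `(0, 0, 0)`, where
`2n ≤ d`. -/
def canonicalMatrix (d n : ℕ) : Matrix (Fin d) (Fin d) ℝ := fun μ ν =>
  if (μ : ℕ) < n ∧ (ν : ℕ) = μ + n then 1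
  else if (ν : ℕ) < n ∧ (μ : ℕ) = ν + n then -1
  else 0

/-- The coefficients of the Moyal product on `U`:
`(1/k!) (i/2)^k ∑ P^{μ_1 ν_1} ⋯ P^{μ_k ν_k} (∂_{μ_1} ⋯ ∂_{μ_k} f) (∂_{ν_1} ⋯ ∂_{ν_k} g)`. -/
def moyal {d : ℕ} (U : TopologicalSpace.Opens (Eucl d)) (n k : ℕ) : Bilin (CInf U) :=
  ((1 / (k.factorial : ℂ)) * (Complex.I / 2) ^ k) •
    ∑ μ : Fin k → Fin d, ∑ ν : Fin k → Fin d,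
      ((∏ j, canonicalMatrix d n (μ j) (ν j) : ℝ) : ℂ) •
        (LinearMap.mul ℂ (CInf U)).compl₁₂ (pderivWord U μ) (pderivWord U ν)

/-! ### Manifolds, coordinate systems, Poisson tensors -/

section Manifold

variable (d : ℕ) (M : Type*) [TopologicalSpace M] [ChartedSpace (Eucl d) M]

/-- The `ℂ`-algebra `C^∞(M)` of smooth complex-valued functions on `M`. -/
def SmoothFn : Subalgebra ℂ (M → ℂ) where
  carrier := {f | ContMDiff (𝓡 d) 𝓘(ℝ, ℂ) ∞ f}
  mul_mem' hf hg :=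
    (contDiff_mul (𝕜 := ℝ) (𝔸 := ℂ)).contMDiff.comp (ContMDiff.prodMk_space hf hg)
  add_mem' hf hg := (contDiff_add (𝕜 := ℝ) (F := ℂ)).contMDiff.comp (ContMDiff.prodMk_space hf hg)
  algebraMap_mem' _ := contMDiff_const

/-- A coordinate system on an open domain `𝒪 ⊆ M`: a chart in the maximal smooth atlas. Its
domain is `x.1.source` and its image is the open set `x.1.target ⊆ ℝ^d`. -/
abbrev CoordSystem : Type _ :=
  {x : OpenPartialHomeomorph M (Eucl d) // x ∈ IsManifold.maximalAtlas (𝓡 d) ∞ M}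

/-- A Poisson tensor on `M`: a smooth bivector field `P`, given by an antisymmetric bilinear form
`P_p` on each cotangent space, for which `{f, g} = P(df, dg)` satisfies the Jacobi identity. -/
structure PoissonTensor where
  /-- The bilinear form `P_p` on the cotangent space at `p`. -/
  form : ∀ p : M, (TangentSpace (𝓡 d) p →L[ℝ] ℝ) →ₗ[ℝ] (TangentSpace (𝓡 d) p →L[ℝ] ℝ) →ₗ[ℝ] ℝ
  antisymm : ∀ p a b, form p a b = - form p b a
  smooth : ∀ f g : M → ℝ, ContMDiff (𝓡 d) 𝓘(ℝ, ℝ) ∞ f → ContMDiff (𝓡 d) 𝓘(ℝ, ℝ) ∞ g →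
    ContMDiff (𝓡 d) 𝓘(ℝ, ℝ) ∞
      (fun p => form p (mfderiv (𝓡 d) 𝓘(ℝ, ℝ) f p) (mfderiv (𝓡 d) 𝓘(ℝ, ℝ) g p))
  jacobi : ∀ f g h : M → ℝ, ContMDiff (𝓡 d) 𝓘(ℝ, ℝ) ∞ f → ContMDiff (𝓡 d) 𝓘(ℝ, ℝ) ∞ g →
    ContMDiff (𝓡 d) 𝓘(ℝ, ℝ) ∞ h →
    let br : (M → ℝ) → (M → ℝ) → M → ℝ := fun u v p =>
      form p (mfderiv (𝓡 d) 𝓘(ℝ, ℝ) u p) (mfderiv (𝓡 d) 𝓘(ℝ, ℝ) v p)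
    ∀ p, br f (br g h) p + br g (br h f) p + br h (br f g) p = 0

variable {d M}

/-- The value at `p` of the Poisson bracket `{f, g} = P(df, dg)` of real functions that are smooth
near `p`. -/
def PoissonTensor.bracketReal (P : PoissonTensor d M) (f g : M → ℝ) (p : M) : ℝ :=
  P.form p (mfderiv (𝓡 d) 𝓘(ℝ, ℝ) f p) (mfderiv (𝓡 d) 𝓘(ℝ, ℝ) g p)

/-- The `ℂ`-bilinear extension of the Poisson bracket to complex-valued functions. -/
def PoissonTensor.bracket (P : PoissonTensor d M) (f g : M → ℂ) (p : M) : ℂ :=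
  ((P.bracketReal (fun q => (f q).re) (fun q => (g q).re) p
      - P.bracketReal (fun q => (f q).im) (fun q => (g q).im) p : ℝ) : ℂ)
    + Complex.I *
      ((P.bracketReal (fun q => (f q).re) (fun q => (g q).im) p
        + P.bracketReal (fun q => (f q).im) (fun q => (g q).re) p : ℝ) : ℂ)

/-- The image `U ⊆ ℝ^d` of a coordinate system. -/
def CoordSystem.image (x : CoordSystem d M) : TopologicalSpace.Opens (Eucl d) :=
  ⟨x.1.target, x.1.open_target⟩

/-- A smooth function on `M`, restricted to the domain of `x` and written in the coordinates `x`. -/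
def CoordSystem.restrict [IsManifold (𝓡 d) ∞ M] (x : CoordSystem d M) (f : SmoothFn d M) :
    CInf x.image :=
  ⟨fun y => f.1 (x.1.symm y),
    mem_CInf_of_contDiffOn (fun y => f.1 (x.1.symm y))
      (contMDiffOn_iff_contDiffOn.mp
        (ContMDiff.comp_contMDiffOn (I' := 𝓡 d) f.2
          (contMDiffOn_symm_of_mem_maximalAtlas x.2)))⟩

/-- `B'` is the bidifferential operator that represents `B` in the coordinates `x`. -/
def Represents [IsManifold (𝓡 d) ∞ M] (x : CoordSystem d M) (B : Bilin (SmoothFn d M))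
    (B' : Bilin (CInf x.image)) : Prop :=
  IsBidiffOp B' ∧ ∀ f g, x.restrict (B f g) = B' (x.restrict f) (x.restrict g)

/-- `B` is a bidifferential operator on `M`: in every coordinate system it is given by a
bidifferential operator on the image. -/
def IsBidiffOpOn [IsManifold (𝓡 d) ∞ M] (B : Bilin (SmoothFn d M)) : Prop :=
  ∀ x : CoordSystem d M, ∃ B' : Bilin (CInf x.image), Represents x B B'

/-- A star-product on the Poisson manifold `(M, P)`. -/
structure StarProduct [IsManifold (𝓡 d) ∞ M] (P : PoissonTensor d M) where
  /-- The coefficients in `f ⋆ g = ∑ k, ħ^k C_k(f, g)`. -/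
  C : ℕ → Bilin (SmoothFn d M)
  bidiff : ∀ k, IsBidiffOpOn (C k)
  zero : ∀ f g, C 0 f g = f * g
  one : ∀ f g p, (C 1 f g - C 1 g f).1 p = Complex.I * P.bracket f.1 g.1 p
  assoc : ∀ k f g h,
    ∑ a ∈ Finset.HasAntidiagonal.antidiagonal k, (C a.1 (C a.2 f g) h - C a.1 f (C a.2 g h)) = 0
  unit : ∀ k, 1 ≤ k → ∀ f, C k f 1 = 0 ∧ C k 1 f = 0

/-- The coefficients `C_k` of the product `⋆^(x)` on `C^∞(U)⟦ħ⟧`, i.e. of the star-product written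
in the coordinates `x`. On a Hausdorff manifold a bidifferential operator on `U` is determined by
its values on restrictions of smooth functions on `M`, so there is only one candidate. -/
def StarProduct.coeffIn [IsManifold (𝓡 d) ∞ M] {P : PoissonTensor d M} (star : StarProduct P)
    (x : CoordSystem d M) (k : ℕ) : Bilin (CInf x.image) :=
  (star.bidiff k x).choose

/-- `{x^μ, x^ν} = P^{μν}` with `P^{μν}` the canonical matrix. -/
def IsClassicalCanonical (P : PoissonTensor d M) (n : ℕ) (x : CoordSystem d M) : Prop :=
  ∀ p ∈ x.1.source, ∀ μ ν : Fin d,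
    P.bracketReal (fun q => x.1 q μ) (fun q => x.1 q ν) p = canonicalMatrix d n μ ν

/-- `⟦x^μ, x^ν⟧_⋆ = P^{μν}` with `P^{μν}` the canonical matrix. -/
def IsQuantumCanonical [IsManifold (𝓡 d) ∞ M] {P : PoissonTensor d M} (star : StarProduct P)
    (n : ℕ) (x : CoordSystem d M) : Prop :=
  ∀ μ ν : Fin d,
    deformedBracket (star.coeffIn x)
        (PowerSeries.C (coordFn x.image μ)) (PowerSeries.C (coordFn x.image ν))
      = PowerSeries.C (algebraMap ℂ (CInf x.image) (canonicalMatrix d n μ ν : ℂ))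

end Manifold

/-! ### The equivalence morphism -/

/-- `S = id + ∑_{k ≥ 1} ħ^k S_k` with differential operators `S_k` on `C^∞(U)`. -/
def IsFormalDiffSeries {d : ℕ} {U : TopologicalSpace.Opens (Eucl d)}
    (S : ℕ → Module.End ℂ (CInf U)) : Prop :=
  S 0 = LinearMap.id ∧ ∀ k, 1 ≤ k → IsDiffOp (S k)

/-- `S(f ⋆_M g) = S f ⋆ S g` for all `f, g ∈ C^∞(U)⟦ħ⟧`, where `⋆_M` is the Moyal product and `⋆`
has coefficients `C_k`. -/
def Intertwines {d : ℕ} {U : TopologicalSpace.Opens (Eucl d)} (n : ℕ) (C : ℕ → Bilin (CInf U))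
    (S : ℕ → Module.End ℂ (CInf U)) : Prop :=
  ∀ f g : PowerSeries (CInf U),
    formalOperator S (formalProduct (moyal U n) f g)
      = formalProduct C (formalOperator S f) (formalOperator S g)

/-- `S x^α = x^α` for all `α`. -/
def FixesCoords {d : ℕ} {U : TopologicalSpace.Opens (Eucl d)}
    (S : ℕ → Module.End ℂ (CInf U)) : Prop :=
  ∀ α, formalOperator S (PowerSeries.C (coordFn U α)) = PowerSeries.C (coordFn U α)

/-- `[S_k, x^α](f) = ½ ∑_{l=1}^k (C_l(x^α, S_{k-l} f) + C_l(S_{k-l} f, x^α))` for all `k ≥ 1`. -/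
def Recurrence {d : ℕ} {U : TopologicalSpace.Opens (Eucl d)} (C : ℕ → Bilin (CInf U))
    (S : ℕ → Module.End ℂ (CInf U)) : Prop :=
  ∀ k, 1 ≤ k → ∀ (α : Fin d) (f : CInf U),
    S k (coordFn U α * f) - coordFn U α * S k f
      = (1 / 2 : ℂ) • ∑ l ∈ Finset.Icc 1 k,
          (C l (coordFn U α) (S (k - l) f) + C l (S (k - l) f) (coordFn U α))

end StarProd

end

/-! Put $s_\alpha F=\frac12(x^\alpha\star F+F\star x^\alpha)$. Once its $l=0$ term is included, the
recurrence says $S(x^\alpha f)=s_\alpha(Sf)$ (`IsStar.recurrenceAt_iff`).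

Uniqueness. For the Moyal product the symmetrized multiplication by a coordinate is the ordinary
one, so an intertwiner that fixes the coordinates satisfies the recurrence
(`IsStar.recurrenceAt_of_intertwines`). It also fixes $1$, since the image of $1$ is an idempotent
with leading term $1$. A differential operator that commutes with all coordinates and kills $1$ is
zero, so two solutions cannot differ at a lowest order.

Existence. Order $k$ asks for $S_k$ with $[S_k,x^\alpha]=E_\alpha$, where the $E_\alpha$ are known.
By a Poincaré lemma on symbols (`exists_adCoord_eq`) this is solvable if
$[E_\alpha,x^\beta]=[E_\beta,x^\alpha]$. That condition reflects $s_\alpha s_\beta=s_\beta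
s_\alpha$: left multiplications by $x^\alpha,x^\beta$ have commutator $i\hbar J^{\alpha\beta}$,
right ones $-i\hbar J^{\alpha\beta}$, and the two cancel (`IsStar.symMul_comm`).

Morphism property. The defect of $S$ on $x^\alpha\star_M f$, and then on $f\star_M g$ with $g$
fixed, is a series of differential operators in $f$. It kills $1$, and its first nonzero coefficient
would commute with the coordinates, so it vanishes. -/

noncomputable section

namespace StarProd

/-! ### Partial derivatives on $C^\infty(U)$ and locality of differential operators. -/

section Calculus

variable {d : ℕ} {U : TopologicalSpace.Opens (Eucl d)}

theorem ext0_mul (f g : U → ℂ) : ext0 (f * g) = ext0 f * ext0 g := by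
  have := Function.extend_mul (Subtype.val : U → Eucl d) f g (0 : Eucl d → ℂ) 0
  simpa [ext0] using this

theorem ext0_eventuallyEq (F : Eucl d → ℂ) (y : U) :
    ext0 (fun z : U => F z) =ᶠ[nhds (y : Eucl d)] F := by
  filter_upwards [U.isOpen.mem_nhds y.2] with z hz
  exact ext0_apply (fun z : U => F z) ⟨z, hz⟩

theorem ext0_contDiffAt (f : CInf U) (y : U) : ContDiffAt ℝ ∞ (ext0 f.1) (y : Eucl d) :=
  f.2.contDiffAt (U.isOpen.mem_nhds y.2)

theorem ext0_differentiableAt (f : CInf U) (y : U) :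
    DifferentiableAt ℝ (ext0 f.1) (y : Eucl d) :=
  (ext0_contDiffAt f y).differentiableAt (by simp)

theorem pderiv_apply (i : Fin d) (f : CInf U) (y : U) :
    (pderiv U i f).1 y = fderiv ℝ (ext0 f.1) y (EuclideanSpace.single i 1) := rfl

theorem pderiv_mul (i : Fin d) (f g : CInf U) :
    pderiv U i (f * g) = f * pderiv U i g + g * pderiv U i f := by
  ext y
  have h : ext0 (f * g).1 = ext0 f.1 * ext0 g.1 := ext0_mul f.1 g.1
  change fderiv ℝ (ext0 (f * g).1) y _ = f.1 y * fderiv ℝ (ext0 g.1) y _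
    + g.1 y * fderiv ℝ (ext0 f.1) y _
  rw [h, fderiv_mul (ext0_differentiableAt f y) (ext0_differentiableAt g y), ext0_apply, ext0_apply]
  rfl

theorem pderiv_comm (i j : Fin d) (f : CInf U) :
    pderiv U i (pderiv U j f) = pderiv U j (pderiv U i f) := by
  have key : ∀ (i j : Fin d) (y : U), (pderiv U i (pderiv U j f)).1 y
      = fderiv ℝ (fderiv ℝ (ext0 f.1)) y (EuclideanSpace.single i 1)
          (EuclideanSpace.single j 1) := by
    intro i j y
    rw [pderiv_apply]
    have h := ext0_eventuallyEq
      (fun z => fderiv ℝ (ext0 f.1) z (EuclideanSpace.single j 1)) y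
    have h' : ext0 (pderiv U j f).1 =ᶠ[nhds (y : Eucl d)]
      (fun z => fderiv ℝ (ext0 f.1) z (EuclideanSpace.single j 1)) := h
    rw [h'.fderiv_eq]
    have hd : DifferentiableAt ℝ (fderiv ℝ (ext0 f.1)) (y : Eucl d) :=
      ((ext0_contDiffAt f y).fderiv_right (m := ∞) (by simp)).differentiableAt
        (by simp)
    rw [fderiv_clm_apply hd (differentiableAt_const _)]
    simp
  ext y
  rw [key, key]
  have := (ext0_contDiffAt f y).isSymmSndFDerivAt (by
    rw [minSmoothness_of_isRCLikeNormedField]; exact WithTop.coe_le_coe.2 le_top)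
  exact this _ _

theorem pderiv_coordFn (i j : Fin d) :
    pderiv U i (coordFn U j) = if i = j then 1 else 0 := by
  ext y
  rw [pderiv_apply]
  have h : ext0 (coordFn U j).1 =ᶠ[nhds (y : Eucl d)] (fun z => ((z j : ℝ) : ℂ)) :=
    ext0_eventuallyEq (fun z => ((z j : ℝ) : ℂ)) y
  rw [h.fderiv_eq]
  have : HasFDerivAt (fun z : Eucl d => ((z j : ℝ) : ℂ))
      (Complex.ofRealCLM.comp (EuclideanSpace.proj (𝕜 := ℝ) j)) (y : Eucl d) :=
    (Complex.ofRealCLM.comp (EuclideanSpace.proj (𝕜 := ℝ) j)).hasFDerivAt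
  rw [this.fderiv]
  by_cases hij : i = j
  · subst hij; simp
  · simp [hij, Ne.symm hij]

/-- Locality is recorded for germs rather than values, so that it can be iterated through
compositions of operators. -/
theorem pderiv_congr {f g : CInf U} {y : U}
    (h : ext0 f.1 =ᶠ[nhds (y : Eucl d)] ext0 g.1) (i : Fin d) :
    ext0 (pderiv U i f).1 =ᶠ[nhds (y : Eucl d)] ext0 (pderiv U i g).1 := by
  filter_upwards [h.fderiv (𝕜 := ℝ), U.isOpen.mem_nhds y.2] with z hz hzU
  rw [ext0_apply (pderiv U i f).1 ⟨z, hzU⟩, ext0_apply (pderiv U i g).1 ⟨z, hzU⟩,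
    pderiv_apply, pderiv_apply, hz]

theorem list_prod_congr (l : List (Module.End ℂ (CInf U))) {y : U}
    (hl : ∀ D ∈ l, ∀ f g : CInf U, ext0 f.1 =ᶠ[nhds (y : Eucl d)] ext0 g.1 →
      ext0 (D f).1 =ᶠ[nhds (y : Eucl d)] ext0 (D g).1)
    {f g : CInf U} (h : ext0 f.1 =ᶠ[nhds (y : Eucl d)] ext0 g.1) :
    ext0 (l.prod f).1 =ᶠ[nhds (y : Eucl d)] ext0 (l.prod g).1 := by
  induction l with
  | nil => simpa using h
  | cons D l ih =>
    rw [List.prod_cons]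
    exact hl D (by simp) _ _ (ih fun D' hD' => hl D' (by simp [hD']))

theorem pow_congr {D : Module.End ℂ (CInf U)} {y : U}
    (hD : ∀ f g : CInf U, ext0 f.1 =ᶠ[nhds (y : Eucl d)] ext0 g.1 →
      ext0 (D f).1 =ᶠ[nhds (y : Eucl d)] ext0 (D g).1) (m : ℕ)
    {f g : CInf U} (h : ext0 f.1 =ᶠ[nhds (y : Eucl d)] ext0 g.1) :
    ext0 ((D ^ m) f).1 =ᶠ[nhds (y : Eucl d)] ext0 ((D ^ m) g).1 := by
  have := list_prod_congr (List.replicate m D) (y := y) (f := f) (g := g)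
    (fun E hE => by rw [List.eq_of_mem_replicate hE]; exact hD) h
  simpa using this

theorem pderivMulti_congr {f g : CInf U} {y : U}
    (h : ext0 f.1 =ᶠ[nhds (y : Eucl d)] ext0 g.1) (I : Fin d → ℕ) :
    ext0 (pderivMulti U I f).1 =ᶠ[nhds (y : Eucl d)] ext0 (pderivMulti U I g).1 := by
  refine list_prod_congr _ (fun D hD f g h => ?_) h
  obtain ⟨i, rfl⟩ := (List.mem_ofFn' _ _).1 hD
  exact pow_congr (fun f g h => pderiv_congr h i) _ h

/-- The value of a bidifferential operator at a point only depends on the germs of its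
arguments. -/
theorem IsBidiffOp.congr_apply {B : Bilin (CInf U)} (hB : IsBidiffOp B) {f f' g g' : CInf U}
    {y : U} (hf : ext0 f.1 =ᶠ[nhds (y : Eucl d)] ext0 f'.1)
    (hg : ext0 g.1 =ᶠ[nhds (y : Eucl d)] ext0 g'.1) : (B f g).1 y = (B f' g').1 y := by
  obtain ⟨s, c, hB⟩ := hB
  have key : ∀ {f f' : CInf U}, ext0 f.1 =ᶠ[nhds (y : Eucl d)] ext0 f'.1 → ∀ I,
      (pderivMulti U I f).1 y = (pderivMulti U I f').1 y := by
    intro f f' h I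
    have := (pderivMulti_congr h I).eq_of_nhds
    rwa [ext0_apply, ext0_apply] at this
  have hsum : ∀ f g : CInf U, (B f g).1 y
      = ∑ IJ ∈ s, (c IJ).1 y * ((pderivMulti U IJ.1 f).1 y * (pderivMulti U IJ.2 g).1 y) := by
    intro f g
    rw [hB]
    simp [Finset.sum_apply]
  rw [hsum, hsum]
  exact Finset.sum_congr rfl fun IJ _ => by rw [key hf, key hg]

/-- Bidifferential operators respect equality of germs. -/
theorem IsBidiffOp.congr_germ {B : Bilin (CInf U)} (hB : IsBidiffOp B) {f f' g g' : CInf U}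
    {y : U} (hf : ext0 f.1 =ᶠ[nhds (y : Eucl d)] ext0 f'.1)
    (hg : ext0 g.1 =ᶠ[nhds (y : Eucl d)] ext0 g'.1) :
    ext0 (B f g).1 =ᶠ[nhds (y : Eucl d)] ext0 (B f' g').1 := by
  filter_upwards [hf.eventuallyEq_nhds, hg.eventuallyEq_nhds, U.isOpen.mem_nhds y.2]
    with z hfz hgz hz
  rw [ext0_apply (B f g).1 ⟨z, hz⟩, ext0_apply (B f' g').1 ⟨z, hz⟩]
  exact hB.congr_apply (y := ⟨z, hz⟩) hfz hgz

end Calculus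

/-! ### Formal products, and symmetrized multiplication in a star product. -/

section Formal

open PowerSeries Finset

variable {A : Type*} [CommRing A] [Algebra ℂ A]

/-- The operator `∑ k, ħ^k S_k` on `A⟦ħ⟧` as a `ℂ`-linear map. -/
def opMap (S : ℕ → Module.End ℂ A) : PowerSeries A →ₗ[ℂ] PowerSeries A where
  toFun := formalOperator S
  map_add' F G := by
    ext m
    simp [formalOperator, sum_add_distrib]
  map_smul' c F := by
    ext m
    simp [formalOperator, smul_sum]

theorem coeff_opMap (S : ℕ → Module.End ℂ A) (F : PowerSeries A) (m : ℕ) :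
    coeff m (opMap S F) = ∑ a ∈ antidiagonal m, S a.1 (coeff a.2 F) := by
  simp [opMap, formalOperator]

theorem coeff_opMap_C (S : ℕ → Module.End ℂ A) (f : A) (m : ℕ) :
    coeff m (opMap S (C f)) = S m f := by
  rw [coeff_opMap, sum_eq_single (m, 0)]
  · simp
  · rintro ⟨a, b⟩ hab hne
    rw [Finset.HasAntidiagonal.mem_antidiagonal] at hab
    have : b ≠ 0 := by rintro rfl; exact hne (by simpa using hab)
    simp [coeff_C, this]
  · intro h; simp at h

/-- The product on `A⟦ħ⟧` with coefficients `B_k` as a `ℂ`-bilinear map. -/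
def starMul (B : ℕ → Bilin A) : PowerSeries A →ₗ[ℂ] PowerSeries A →ₗ[ℂ] PowerSeries A :=
  LinearMap.mk₂ ℂ (formalProduct B)
    (fun F F' G => by ext m; simp [formalProduct, sum_add_distrib])
    (fun c F G => by ext m; simp [formalProduct, smul_sum])
    (fun F G G' => by ext m; simp [formalProduct, sum_add_distrib])
    (fun c F G => by ext m; simp [formalProduct, smul_sum])

theorem coeff_starMul (B : ℕ → Bilin A) (F G : PowerSeries A) (m : ℕ) :
    coeff m (starMul B F G) = ∑ a ∈ antidiagonal m, ∑ b ∈ antidiagonal a.2,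
      B a.1 (coeff b.1 F) (coeff b.2 G) := by
  simp [starMul, formalProduct]

/-- Freezing an $\hbar$-independent factor turns the product into a series of operators, which may
then be differential operators. -/
theorem starMul_C_left (B : ℕ → Bilin A) (f : A) (G : PowerSeries A) :
    starMul B (C f) G = opMap (fun k => B k f) G := by
  ext m
  rw [coeff_starMul, coeff_opMap]
  refine sum_congr rfl fun a _ => ?_
  rw [sum_eq_single (0, a.2)]
  · simp
  · rintro ⟨i, j⟩ hij hne
    rw [Finset.HasAntidiagonal.mem_antidiagonal] at hij
    have : i ≠ 0 := by rintro rfl; exact hne (by simpa using hij)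
    simp [coeff_C, this]
  · intro h; simp at h

theorem starMul_C_right (B : ℕ → Bilin A) (g : A) (F : PowerSeries A) :
    starMul B F (C g) = opMap (fun k => (B k).flip g) F := by
  ext m
  rw [coeff_starMul, coeff_opMap]
  refine sum_congr rfl fun a _ => ?_
  rw [sum_eq_single (a.2, 0)]
  · simp
  · rintro ⟨i, j⟩ hij hne
    rw [Finset.HasAntidiagonal.mem_antidiagonal] at hij
    have : j ≠ 0 := by rintro rfl; exact hne (by simpa using hij)
    simp [coeff_C, this]
  · intro h; simp at h

theorem coeff_starMul_C_C (B : ℕ → Bilin A) (f g : A) (m : ℕ) :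
    coeff m (starMul B (C f) (C g)) = B m f g := by
  rw [starMul_C_left, coeff_opMap_C]

theorem opMap_X_mul (S : ℕ → Module.End ℂ A) (F : PowerSeries A) :
    opMap S (X * F) = X * opMap S F := by
  ext (_ | m)
  · simp [coeff_opMap]
  · rw [coeff_succ_X_mul, coeff_opMap, coeff_opMap, Nat.sum_antidiagonal_succ']
    simp [coeff_succ_X_mul]

theorem starMul_X_mul_left (B : ℕ → Bilin A) (F G : PowerSeries A) :
    starMul B (X * F) G = X * starMul B F G := by
  ext (_ | m)
  · simp [coeff_starMul]
  · rw [coeff_succ_X_mul, coeff_starMul, coeff_starMul, Nat.sum_antidiagonal_succ']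
    simp [Nat.sum_antidiagonal_succ, coeff_succ_X_mul]

theorem starMul_X_mul_right (B : ℕ → Bilin A) (F G : PowerSeries A) :
    starMul B F (X * G) = X * starMul B F G := by
  ext (_ | m)
  · simp [coeff_starMul]
  · rw [coeff_succ_X_mul, coeff_starMul, coeff_starMul, Nat.sum_antidiagonal_succ']
    simp [Nat.sum_antidiagonal_succ', coeff_succ_X_mul]

theorem X_mul_smul (c : ℂ) (F : PowerSeries A) : (X : PowerSeries A) * c • F = c • (X * F) := by
  ext (_ | m) <;> simp [coeff_succ_X_mul]

/-- Two `ℂ`-linear maps on `A⟦ħ⟧` which commute with `ħ` are equal if they agree on `A`. -/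
theorem ext_of_C {V W : PowerSeries A →ₗ[ℂ] PowerSeries A}
    (hV : ∀ F, V (X * F) = X * V F) (hW : ∀ F, W (X * F) = X * W F)
    (h : ∀ f, V (C f) = W (C f)) : V = W := by
  have key : ∀ m F, coeff m (V F) = coeff m (W F) := by
    intro m
    induction m with
    | zero =>
      intro F
      -- Splitting off the constant term lowers the coefficient index by one, so no $\hbar$-adic
      -- continuity argument is required.
      rw [eq_X_mul_shift_add_const F, map_add V, map_add W, hV, hW, h, map_add, map_add,
        coeff_zero_X_mul, coeff_zero_X_mul]
    | succ m ih =>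
      intro F
      rw [eq_X_mul_shift_add_const F, map_add V, map_add W, hV, hW, h, map_add, map_add,
        coeff_succ_X_mul, coeff_succ_X_mul, ih]
  ext F m
  exact key m F

/-- Two `ℂ`-bilinear maps on `A⟦ħ⟧` which commute with `ħ` are equal if they agree on `A`. -/
theorem ext_of_C₂ {V W : PowerSeries A →ₗ[ℂ] PowerSeries A →ₗ[ℂ] PowerSeries A}
    (hV : ∀ F G, V (X * F) G = X * V F G) (hV' : ∀ F G, V F (X * G) = X * V F G)
    (hW : ∀ F G, W (X * F) G = X * W F G) (hW' : ∀ F G, W F (X * G) = X * W F G)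
    (h : ∀ f g, V (C f) (C g) = W (C f) (C g)) : V = W := by
  have h1 : ∀ f, V (C f) = W (C f) := fun f => ext_of_C (hV' _) (hW' _) (h f)
  ext1 F
  refine LinearMap.ext fun G => ?_
  have h2 : V.flip G = W.flip G := ext_of_C (fun F => hV F G) (fun F => hW F G)
    (fun f => by simp [h1])
  exact LinearMap.congr_fun h2 F

/-- The part of the axioms of a star product that concerns a single commutative algebra. -/
structure IsStar (B : ℕ → Bilin A) : Prop where
  zero : ∀ f g, B 0 f g = f * g
  assoc : ∀ k f g h,
    ∑ a ∈ antidiagonal k, (B a.1 (B a.2 f g) h - B a.1 f (B a.2 g h)) = 0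
  unit_right : ∀ k, 1 ≤ k → ∀ f, B k f 1 = 0
  unit_left : ∀ k, 1 ≤ k → ∀ f, B k 1 f = 0

variable {B : ℕ → Bilin A}

theorem opMap_eq_smul {S : ℕ → Module.End ℂ A} {c : ℂ} (h0 : ∀ f, S 0 f = c • f)
    (h : ∀ k, 1 ≤ k → ∀ f, S k f = 0) (F : PowerSeries A) : opMap S F = c • F := by
  have : opMap S = c • LinearMap.id := by
    refine ext_of_C (opMap_X_mul S) (fun F => ?_) (fun f => ?_)
    · simp
    · ext (_ | m)
      · rw [coeff_opMap_C, h0]; simp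
      · rw [coeff_opMap_C, h _ (by omega)]; simp
  rw [this]; rfl

theorem IsStar.C_algebraMap_mul (hB : IsStar B) (c : ℂ) (F : PowerSeries A) :
    starMul B (C (algebraMap ℂ A c)) F = c • F := by
  rw [starMul_C_left]
  refine opMap_eq_smul (fun f => ?_) (fun k hk f => ?_) F
  · rw [hB.zero, Algebra.smul_def]
  · rw [Algebra.algebraMap_eq_smul_one, map_smul, LinearMap.smul_apply, hB.unit_left k hk,
      smul_zero]

theorem IsStar.mul_C_algebraMap (hB : IsStar B) (c : ℂ) (F : PowerSeries A) :
    starMul B F (C (algebraMap ℂ A c)) = c • F := by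
  rw [starMul_C_right]
  refine opMap_eq_smul (fun f => ?_) (fun k hk f => ?_) F
  · rw [LinearMap.flip_apply, hB.zero, Algebra.smul_def, mul_comm]
  · rw [Algebra.algebraMap_eq_smul_one, LinearMap.flip_apply, map_smul, hB.unit_right k hk,
      smul_zero]

theorem IsStar.one_mul (hB : IsStar B) (F : PowerSeries A) : starMul B (C 1) F = F := by
  simpa using hB.C_algebraMap_mul 1 F

theorem IsStar.mul_one (hB : IsStar B) (F : PowerSeries A) : starMul B F (C 1) = F := by
  simpa using hB.mul_C_algebraMap 1 F

/-- The axiom `assoc` is the case of three constants; each slot is then freed in turn by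
$\hbar$-linearity. -/
theorem IsStar.mul_assoc (hB : IsStar B) (F G H : PowerSeries A) :
    starMul B (starMul B F G) H = starMul B F (starMul B G H) := by
  have h1 : ∀ f g h : A, starMul B (starMul B (C f) (C g)) (C h)
      = starMul B (C f) (starMul B (C g) (C h)) := by
    intro f g h
    ext m
    rw [starMul_C_left B f (starMul B (C g) (C h)), starMul_C_right, coeff_opMap, coeff_opMap]
    simp only [coeff_starMul_C_C, LinearMap.flip_apply]
    rw [← sub_eq_zero, ← sum_sub_distrib]
    exact hB.assoc m f g h
  have h2 : ∀ (f g : A) H, starMul B (starMul B (C f) (C g)) H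
      = starMul B (C f) (starMul B (C g) H) := fun f g H =>
    LinearMap.congr_fun (ext_of_C (V := starMul B (starMul B (C f) (C g)))
      (W := (starMul B (C f)).comp (starMul B (C g)))
      (fun H => starMul_X_mul_right _ _ _)
      (fun H => by simp [starMul_X_mul_right]) (fun h => h1 f g h)) H
  have h3 : ∀ (f : A) G H, starMul B (starMul B (C f) G) H
      = starMul B (C f) (starMul B G H) := fun f G H =>
    LinearMap.congr_fun (ext_of_C (V := ((starMul B).flip H).comp (starMul B (C f)))
      (W := (starMul B (C f)).comp ((starMul B).flip H))
      (fun G => by simp [starMul_X_mul_right, starMul_X_mul_left])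
      (fun G => by simp [starMul_X_mul_right, starMul_X_mul_left]) (fun g => h2 f g H)) G
  exact LinearMap.congr_fun (ext_of_C (V := ((starMul B).flip H).comp ((starMul B).flip G))
      (W := (starMul B).flip (starMul B G H))
      (fun F => by simp [starMul_X_mul_left])
      (fun F => by simp [starMul_X_mul_left]) (fun f => h3 f G H)) F

/-- Symmetrized multiplication by `f ∈ A`, i.e. `F ↦ ½ (f ⋆ F + F ⋆ f)`. -/
def symMul (B : ℕ → Bilin A) (f : A) : PowerSeries A →ₗ[ℂ] PowerSeries A :=
  (1 / 2 : ℂ) • (starMul B (C f) + (starMul B).flip (C f))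

theorem symMul_apply (f : A) (F : PowerSeries A) :
    symMul B f F = (1 / 2 : ℂ) • (starMul B (C f) F + starMul B F (C f)) := rfl

theorem symMul_X_mul (f : A) (F : PowerSeries A) : symMul B f (X * F) = X * symMul B f F := by
  rw [symMul_apply, symMul_apply, starMul_X_mul_left, starMul_X_mul_right, ← mul_add, X_mul_smul]

theorem symMul_X_pow_mul (f : A) (k : ℕ) (F : PowerSeries A) :
    symMul B f (X ^ k * F) = X ^ k * symMul B f F := by
  induction k with
  | zero => simp
  | succ k ih => rw [pow_succ', _root_.mul_assoc, symMul_X_mul, ih, _root_.mul_assoc]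

theorem coeff_symMul (f : A) (F : PowerSeries A) (m : ℕ) :
    coeff m (symMul B f F)
      = (1 / 2 : ℂ) • ∑ a ∈ antidiagonal m,
          (B a.1 f (coeff a.2 F) + B a.1 (coeff a.2 F) f) := by
  rw [symMul_apply, PowerSeries.coeff_smul, map_add, starMul_C_left, starMul_C_right, coeff_opMap,
    coeff_opMap, ← sum_add_distrib]
  rfl

/-- Separates the ordinary product ($l=0$) from the terms that form the right-hand side of the
recurrence. -/
theorem IsStar.coeff_symMul (hB : IsStar B) (f : A) (F : PowerSeries A) (m : ℕ) :
    coeff m (symMul B f F) = f * coeff m F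
      + (1 / 2 : ℂ) • ∑ l ∈ Icc 1 m, (B l f (coeff (m - l) F) + B l (coeff (m - l) F) f) := by
  rw [StarProd.coeff_symMul, Nat.sum_antidiagonal_eq_sum_range_succ
    (fun i j => B i f (coeff j F) + B i (coeff j F) f) m, range_eq_Ico,
    sum_eq_sum_Ico_succ_bot (by omega)]
  have : Ico (0 + 1) m.succ = Icc 1 m := by ext; simp
  rw [this, smul_add, hB.zero, hB.zero, Nat.sub_zero, mul_comm (coeff m F) f, ← two_smul ℂ,
    smul_smul]
  norm_num

/-- `f ⋆ g - g ⋆ f = ħ c` with `c ∈ ℂ`. -/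
def HasScalarCommutator (B : ℕ → Bilin A) (f g : A) (c : ℂ) : Prop :=
  starMul B (C f) (C g) - starMul B (C g) (C f) = X * C (algebraMap ℂ A c)

theorem IsStar.leftMul_commutator (hB : IsStar B) {f g : A} {c : ℂ}
    (h : HasScalarCommutator B f g c) (F : PowerSeries A) :
    starMul B (C f) (starMul B (C g) F) - starMul B (C g) (starMul B (C f) F)
      = X * c • F := by
  rw [← hB.mul_assoc, ← hB.mul_assoc, ← LinearMap.sub_apply, ← map_sub, h, starMul_X_mul_left,
    hB.C_algebraMap_mul]

theorem IsStar.rightMul_commutator (hB : IsStar B) {f g : A} {c : ℂ}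
    (h : HasScalarCommutator B f g c) (F : PowerSeries A) :
    starMul B (starMul B F (C f)) (C g) - starMul B (starMul B F (C g)) (C f)
      = X * c • F := by
  rw [hB.mul_assoc, hB.mul_assoc, ← map_sub, h, starMul_X_mul_right, hB.mul_C_algebraMap]

/-- By associativity left and right multiplications commute with each other. The commutators
$[L_f,L_g]=\hbar c$ and $[R_f,R_g]=-\hbar c$ cancel in the symmetrization. This is the source of the
integrability of the recurrence. -/
theorem IsStar.symMul_comm (hB : IsStar B) {f g : A} {c : ℂ}
    (h : HasScalarCommutator B f g c) (F : PowerSeries A) :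
    symMul B f (symMul B g F) = symMul B g (symMul B f F) := by
  have hl := hB.leftMul_commutator h F
  have hr := hB.rightMul_commutator h F
  simp only [symMul_apply, map_add, map_smul]
  congr 1
  rw [← smul_add, ← smul_add]
  congr 1
  rw [hB.mul_assoc (C f) F (C g), hB.mul_assoc (C g) F (C f)]
  rw [← hr] at hl
  linear_combination (exp := 1) hl

/-- Only the half of `symMul` that multiplies from the left fails to commute with $L_f$, whence
$\hbar c/2$. -/
theorem IsStar.leftMul_symMul (hB : IsStar B) {f g : A} {c : ℂ}
    (h : HasScalarCommutator B f g c) (F : PowerSeries A) :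
    starMul B (C f) (symMul B g F)
      = symMul B g (starMul B (C f) F) + (c / 2) • (X * F) := by
  have hl := hB.leftMul_commutator h F
  rw [X_mul_smul, sub_eq_iff_eq_add] at hl
  simp only [symMul_apply, map_add, map_smul]
  rw [hl, hB.mul_assoc (C f) F (C g)]
  module

end Formal

/-! ### Algebraic differential operators and the equations $[S,x^\alpha]=E_\alpha$. -/

section DiffOps

variable {A : Type*} [CommRing A] [Algebra ℂ A] {d : ℕ}

/-- Commuting derivations `δ_i` and elements `x_j` of a commutative algebra with
`δ_i x_j = δ_{ij}`. -/
structure IsCoordinates (δ : Fin d → Module.End ℂ A) (x : Fin d → A) : Prop where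
  leibniz : ∀ i f g, δ i (f * g) = f * δ i g + g * δ i f
  comm : ∀ i j, Commute (δ i) (δ j)
  apply_coord : ∀ i j, δ i (x j) = if i = j then 1 else 0

variable {δ : Fin d → Module.End ℂ A} {x : Fin d → A}

theorem IsCoordinates.apply_one (h : IsCoordinates δ x) (i : Fin d) : δ i 1 = 0 := by
  have := h.leibniz i 1 1
  simpa using this

theorem IsCoordinates.apply_coord_mul (h : IsCoordinates δ x) (i j : Fin d) (f : A) :
    δ i (x j * f) = x j * δ i f + if i = j then f else 0 := by
  rw [h.leibniz, h.apply_coord]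
  split_ifs <;> simp

variable (δ) in
/-- The monomial `∏ i, (δ_i)^(I i)`. -/
def multiOp (I : Fin d → ℕ) : Module.End ℂ A := (List.ofFn fun i => δ i ^ I i).prod

theorem multiOp_zero : multiOp δ (0 : Fin d → ℕ) = 1 := by
  simp [multiOp]

theorem list_prod_ofFn_pow_add_single {M : Type*} [Monoid M] {m : ℕ} (a : Fin m → M)
    (ha : ∀ i j, Commute (a i) (a j)) (I : Fin m → ℕ) (i : Fin m) :
    (List.ofFn fun j => a j ^ (I + Pi.single i 1 : Fin m → ℕ) j).prod
      = a i * (List.ofFn fun j => a j ^ I j).prod := by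
  induction m with
  | zero => exact i.elim0
  | succ m ih =>
    simp only [List.ofFn_succ, List.prod_cons]
    refine Fin.cases ?_ (fun i => ?_) i
    · simp [pow_succ', mul_assoc]
    · have h := ih (fun j => a j.succ) (fun _ _ => ha _ _) (fun j => I j.succ) i
      have h' : ∀ j : Fin m, (I + Pi.single i.succ 1 : Fin (m + 1) → ℕ) j.succ
          = ((fun j => I j.succ) + Pi.single i 1 : Fin m → ℕ) j := by
        intro j
        simp [Pi.single_apply]
      simp only [h']
      rw [h, ← mul_assoc, ← mul_assoc]
      congr 1
      simpa using ((ha 0 i.succ).pow_left (I 0)).eq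

theorem IsCoordinates.mul_multiOp (hx : IsCoordinates δ x) (i : Fin d) (I : Fin d → ℕ) :
    δ i * multiOp δ I = multiOp δ (I + Pi.single i 1) :=
  (list_prod_ofFn_pow_add_single δ hx.comm I i).symm

variable (δ) in
/-- The `A`-module of differential operators. -/
def diffOps : Submodule A (Module.End ℂ A) :=
  Submodule.span _ (Set.range (multiOp δ))

theorem mem_diffOps_iff {D : Module.End ℂ A} : D ∈ diffOps δ ↔
    ∃ (s : Finset (Fin d → ℕ)) (c : (Fin d → ℕ) → A), D = ∑ I ∈ s, c I • multiOp δ I := by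
  constructor
  · intro h
    obtain ⟨c, hc⟩ := Finsupp.mem_span_range_iff_exists_finsupp.1 h
    exact ⟨c.support, c, hc.symm⟩
  · rintro ⟨s, c, rfl⟩
    exact sum_mem fun I _ => Submodule.smul_mem _ _ (Submodule.subset_span ⟨I, rfl⟩)

theorem multiOp_mem (I : Fin d → ℕ) : multiOp δ I ∈ diffOps δ :=
  Submodule.subset_span ⟨I, rfl⟩

theorem one_mem_diffOps : (1 : Module.End ℂ A) ∈ diffOps δ := by
  rw [← multiOp_zero]; exact multiOp_mem _

theorem deriv_mul_mem (hx : IsCoordinates δ x) {D : Module.End ℂ A} (hD : D ∈ diffOps δ) (i : Fin d) :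
    δ i * D ∈ diffOps δ := by
  induction hD using Submodule.span_induction with
  | mem D hD =>
    obtain ⟨I, rfl⟩ := hD
    rw [hx.mul_multiOp]
    exact multiOp_mem _
  | zero => simp
  | add D E _ _ hD hE => rw [mul_add]; exact add_mem hD hE
  | smul c D hD ih =>
    have : δ i * c • D = c • (δ i * D) + δ i c • D := by
      ext1 f
      simp [hx.leibniz, mul_comm]
    rw [this]
    exact add_mem (Submodule.smul_mem _ _ ih) (Submodule.smul_mem _ _ hD)

theorem deriv_mem (hx : IsCoordinates δ x) (i : Fin d) : δ i ∈ diffOps δ := by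
  simpa using deriv_mul_mem hx one_mem_diffOps i

theorem list_prod_mul_mem (l : List (Module.End ℂ A))
    (hl : ∀ E ∈ l, ∀ D ∈ diffOps δ, E * D ∈ diffOps δ) {D : Module.End ℂ A}
    (hD : D ∈ diffOps δ) : l.prod * D ∈ diffOps δ := by
  induction l with
  | nil => simpa using hD
  | cons E l ih =>
    rw [List.prod_cons, mul_assoc]
    exact hl E (by simp) _ (ih fun E' hE' => hl E' (by simp [hE']))

/-- Since `diffOps` is a left $A$-module, it suffices to multiply from the left by single
derivations, where the Leibniz rule moves coefficients to the front. -/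
theorem mul_mem_diffOps (hx : IsCoordinates δ x) {D E : Module.End ℂ A} (hD : D ∈ diffOps δ)
    (hE : E ∈ diffOps δ) : D * E ∈ diffOps δ := by
  induction hD using Submodule.span_induction with
  | mem D hD =>
    obtain ⟨I, rfl⟩ := hD
    refine list_prod_mul_mem _ (fun F hF G hG => ?_) hE
    obtain ⟨i, rfl⟩ := (List.mem_ofFn' _ _).1 hF
    have := list_prod_mul_mem (List.replicate (I i) (δ i)) (fun F hF G hG => by
      rw [List.eq_of_mem_replicate hF]; exact deriv_mul_mem hx hG i) hG
    simpa using this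
  | zero => simp
  | add D D' _ _ hD hD' => rw [add_mul]; exact add_mem hD hD'
  | smul c D hD ih =>
    have : c • D * E = c • (D * E) := rfl
    rw [this]
    exact Submodule.smul_mem _ _ ih

theorem complex_smul_mem_diffOps {D : Module.End ℂ A} (hD : D ∈ diffOps δ) (c : ℂ) :
    c • D ∈ diffOps δ := by
  have : c • D = (algebraMap ℂ A c) • D := by
    ext1 f
    simp [Algebra.smul_def]
  rw [this]
  exact Submodule.smul_mem _ _ hD

theorem mulLeft_mem_diffOps (g : A) : LinearMap.mulLeft ℂ g ∈ diffOps δ := by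
  have : LinearMap.mulLeft ℂ g = g • (1 : Module.End ℂ A) := by
    ext1 f
    simp
  rw [this]
  exact Submodule.smul_mem _ _ one_mem_diffOps

variable (x) in
/-- The commutator `D ↦ [D, x^α]`. -/
def adCoord (α : Fin d) : Module.End ℂ (Module.End ℂ A) :=
  LinearMap.mulRight ℂ (LinearMap.mulLeft ℂ (x α))
    - LinearMap.mulLeft ℂ (LinearMap.mulLeft ℂ (x α))

theorem adCoord_apply (α : Fin d) (D : Module.End ℂ A) (f : A) :
    adCoord x α D f = D (x α * f) - x α * D f := rfl

theorem adCoord_mul (α : Fin d) (D E : Module.End ℂ A) :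
    adCoord x α (D * E) = D * adCoord x α E + adCoord x α D * E := by
  ext1 f
  simp [adCoord_apply]

theorem IsCoordinates.adCoord_deriv (hx : IsCoordinates δ x) (α i : Fin d) : adCoord x α (δ i) = if i = α then 1 else 0 := by
  ext1 f
  rw [adCoord_apply, hx.apply_coord_mul]
  split_ifs <;> simp

theorem adCoord_comm (α β : Fin d) (D : Module.End ℂ A) :
    adCoord x α (adCoord x β D) = adCoord x β (adCoord x α D) := by
  ext1 f
  simp only [adCoord_apply, mul_left_comm (x α) (x β)]
  ring

theorem adCoord_smul (α : Fin d) (c : A) (D : Module.End ℂ A) :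
    adCoord x α (c • D) = c • adCoord x α D := by
  ext1 f
  simp only [adCoord_apply, LinearMap.smul_apply, smul_eq_mul]
  ring

theorem adCoord_one (α : Fin d) : adCoord x α 1 = 0 := by
  ext1 f
  simp [adCoord_apply]

theorem adCoord_mem (hx : IsCoordinates δ x) {D : Module.End ℂ A} (hD : D ∈ diffOps δ) (α : Fin d) :
    adCoord x α D ∈ diffOps δ :=
  sub_mem (mul_mem_diffOps hx hD (mulLeft_mem_diffOps _))
    (mul_mem_diffOps hx (mulLeft_mem_diffOps _) hD)

variable (δ x) in
/-- The operator `D ↦ ∑ α, [D, x^α] ∂_α`, for which `c ∂^I` is an eigenvector with eigenvalue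
`|I|`. -/
def eulerOp : Module.End ℂ (Module.End ℂ A) :=
  ∑ α, LinearMap.mulRight ℂ (δ α) ∘ₗ adCoord x α

theorem eulerOp_apply (D : Module.End ℂ A) :
    eulerOp δ x D = ∑ α, adCoord x α D * δ α := by
  simp [eulerOp, LinearMap.sum_apply]

theorem eulerOp_smul (c : A) (D : Module.End ℂ A) :
    eulerOp δ x (c • D) = c • eulerOp δ x D := by
  rw [eulerOp_apply, eulerOp_apply, Finset.smul_sum]
  refine Finset.sum_congr rfl fun α _ => ?_
  rw [adCoord_smul]
  rfl

theorem adCoord_sum_mul_deriv (hx : IsCoordinates δ x) (E : Fin d → Module.End ℂ A) (β : Fin d) :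
    adCoord x β (∑ α, E α * δ α) = ∑ α, adCoord x β (E α) * δ α + E β := by
  rw [map_sum]
  simp only [adCoord_mul, hx.adCoord_deriv, Finset.sum_add_distrib]
  rw [add_comm]
  simp

/-- Taking the commutator with a coordinate lowers the degree by one, which accounts for the extra
summand. -/
theorem adCoord_eulerOp (hx : IsCoordinates δ x) (D : Module.End ℂ A) (β : Fin d) :
    adCoord x β (eulerOp δ x D) = eulerOp δ x (adCoord x β D) + adCoord x β D := by
  rw [eulerOp_apply, eulerOp_apply, adCoord_sum_mul_deriv hx fun α => adCoord x α D]
  simp only [adCoord_comm β]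

/-- `D` is a constant coefficient differential operator, homogeneous of degree `n` and monic
if `n = 0`. -/
structure IsHomogeneousWord (δ : Fin d → Module.End ℂ A) (x : Fin d → A) (n : ℕ) (D : Module.End ℂ A) : Prop where
  commute : ∀ i, Commute D (δ i)
  euler : eulerOp δ x D = (n : ℂ) • D
  eq_one : n = 0 → D = 1

theorem IsHomogeneousWord.one : IsHomogeneousWord δ x 0 (1 : Module.End ℂ A) :=
  ⟨fun _ => Commute.one_left _, by simp [eulerOp_apply, adCoord_one], fun _ => rfl⟩

theorem IsHomogeneousWord.deriv_mul (hx : IsCoordinates δ x) {n : ℕ} {D : Module.End ℂ A}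
    (hD : IsHomogeneousWord δ x n D) (i : Fin d) : IsHomogeneousWord δ x (n + 1) (δ i * D) where
  commute j := (hx.comm i j).mul_left (hD.commute j)
  euler := by
    have h := hD.euler
    rw [eulerOp_apply] at h
    simp only [eulerOp_apply, adCoord_mul, hx.adCoord_deriv, add_mul, Finset.sum_add_distrib,
      mul_assoc]
    rw [← Finset.mul_sum, h]
    simp only [ite_mul, one_mul, zero_mul, Finset.sum_ite_eq, Finset.mem_univ, if_true]
    rw [(hD.commute i).eq, mul_smul_comm]
    push_cast
    module
  eq_one h := by omega

theorem exists_isHomogeneousWord (hx : IsCoordinates δ x) (I : Fin d → ℕ) :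
    ∃ n, IsHomogeneousWord δ x n (multiOp δ I) := by
  have key : ∀ l : List (Module.End ℂ A),
      (∀ E ∈ l, ∃ (i : Fin d) (m : ℕ), E = δ i ^ m) → ∃ n, IsHomogeneousWord δ x n l.prod := by
    intro l hl
    induction l with
    | nil => exact ⟨0, IsHomogeneousWord.one⟩
    | cons E l ih =>
      obtain ⟨n, hn⟩ := ih fun E' hE' => hl E' (by simp [hE'])
      obtain ⟨i, m, rfl⟩ := hl E (by simp)
      rw [List.prod_cons]
      clear hl ih
      induction m with
      | zero => exact ⟨n, by simpa using hn⟩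
      | succ m ih =>
        obtain ⟨n', hn'⟩ := ih
        exact ⟨n' + 1, by rw [pow_succ', mul_assoc]; exact hn'.deriv_mul hx i⟩
  refine key _ fun E hE => ?_
  obtain ⟨i, rfl⟩ := (List.mem_ofFn' _ _).1 hE
  exact ⟨i, I i, rfl⟩

/-- A differential operator is the sum of a multiplication operator and of components of positive
order. -/
theorem exists_sub_mem_iSup_eigenspace (hx : IsCoordinates δ x) {D : Module.End ℂ A} (hD : D ∈ diffOps δ) :
    ∃ c : A, D - c • (1 : Module.End ℂ A)
      ∈ ⨆ n : ℕ, (eulerOp δ x).eigenspace ((n + 1 : ℕ) : ℂ) := by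
  obtain ⟨s, c, rfl⟩ := mem_diffOps_iff.1 hD
  have key : ∀ I, ∃ c' : A, c I • multiOp δ I - c' • (1 : Module.End ℂ A)
      ∈ ⨆ n : ℕ, (eulerOp δ x).eigenspace ((n + 1 : ℕ) : ℂ) := by
    intro I
    obtain ⟨n, hn⟩ := exists_isHomogeneousWord hx I
    cases n with
    | zero => exact ⟨c I, by rw [hn.eq_one rfl, sub_self]; exact zero_mem _⟩
    | succ n =>
      refine ⟨0, Submodule.mem_iSup_of_mem n ?_⟩
      rw [zero_smul, sub_zero, Module.End.mem_eigenspace_iff, eulerOp_smul, hn.euler, smul_comm]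
  choose c' hc' using key
  refine ⟨∑ I ∈ s, c' I, ?_⟩
  rw [Finset.sum_smul, ← Finset.sum_sub_distrib]
  exact sum_mem fun I _ => hc' I

theorem iSup_eigenspace_natCast_le (z : ℂ) (hz : ∀ n : ℕ, ((n + 1 : ℕ) : ℂ) ≠ z) :
    ⨆ n : ℕ, (eulerOp δ x).eigenspace ((n + 1 : ℕ) : ℂ)
      ≤ ⨆ (w : ℂ) (_ : w ≠ z), (eulerOp δ x).eigenspace w :=
  iSup_le fun n => le_iSup₂_of_le ((n + 1 : ℕ) : ℂ) (hz n) le_rfl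

theorem smul_one_mem_eigenspace_zero (c : A) :
    c • (1 : Module.End ℂ A) ∈ (eulerOp δ x).eigenspace 0 := by
  rw [Module.End.mem_eigenspace_iff, eulerOp_smul, IsHomogeneousWord.one.euler]
  simp

/-- A differential operator which commutes with the coordinates and annihilates `1` vanishes. -/
theorem eq_zero_of_adCoord_eq_zero (hx : IsCoordinates δ x) {D : Module.End ℂ A} (hD : D ∈ diffOps δ)
    (h : ∀ α, adCoord x α D = 0) (h1 : D 1 = 0) : D = 0 := by
  obtain ⟨c, hc⟩ := exists_sub_mem_iSup_eigenspace hx hD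
  -- The part of positive degree would also have Euler eigenvalue $0$; independence of eigenspaces
  -- kills it.
  have h0 : D - c • (1 : Module.End ℂ A) ∈ (eulerOp δ x).eigenspace 0 := by
    refine sub_mem ?_ (smul_one_mem_eigenspace_zero c)
    rw [Module.End.mem_eigenspace_iff, eulerOp_apply]
    simp [h]
  have hdis := (eulerOp δ x).eigenspaces_iSupIndep (0 : ℂ)
  have := Submodule.disjoint_def.1 hdis _ h0
    (iSup_eigenspace_natCast_le 0 (fun n => by exact_mod_cast n.succ_ne_zero) hc)
  have hDc : D = c • (1 : Module.End ℂ A) := sub_eq_zero.1 this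
  have hc0 : c = 0 := by simpa [hDc] using h1
  rw [hDc, hc0, zero_smul]

/-- On differential operators the Euler operator has only natural numbers as eigenvalues, so $-1$ is
excluded. -/
theorem eq_zero_of_eulerOp_add_self (hx : IsCoordinates δ x) {D : Module.End ℂ A} (hD : D ∈ diffOps δ)
    (h : eulerOp δ x D + D = 0) : D = 0 := by
  obtain ⟨c, hc⟩ := exists_sub_mem_iSup_eigenspace hx hD
  have hne : ∀ n : ℕ, ((n + 1 : ℕ) : ℂ) ≠ -1 := by
    intro n hn
    have := congrArg Complex.re hn
    simp at this
    linarith [(Nat.cast_nonneg n : (0 : ℝ) ≤ n)]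
  have hdis := (eulerOp δ x).eigenspaces_iSupIndep (-1 : ℂ)
  refine Submodule.disjoint_def.1 hdis _ ?_ ?_
  · rw [Module.End.mem_eigenspace_iff, neg_one_smul]
    exact eq_neg_of_add_eq_zero_left h
  · have h0 := Submodule.mem_iSup_of_mem (p := fun w : ℂ => ⨆ _ : w ≠ -1, (eulerOp δ x).eigenspace w)
      0 (Submodule.mem_iSup_of_mem (by norm_num) (smul_one_mem_eigenspace_zero c))
    simpa using add_mem (iSup_eigenspace_natCast_le (-1) hne hc) h0

/-- The homogeneous parts of $E\,\delta_\alpha$ have positive degree, so each can be divided by its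
eigenvalue. The factor $\delta_\alpha$ on the right makes the result kill $1$. -/
theorem exists_eulerOp_eq_mul_deriv (hx : IsCoordinates δ x) {E : Module.End ℂ A} (hE : E ∈ diffOps δ)
    (α : Fin d) : ∃ S ∈ diffOps δ, S 1 = 0 ∧ eulerOp δ x S = E * δ α := by
  obtain ⟨s, c, rfl⟩ := mem_diffOps_iff.1 hE
  choose n hn using exists_isHomogeneousWord hx
  refine ⟨∑ I ∈ s, c I • (((n I + 1 : ℕ) : ℂ)⁻¹ • (multiOp δ I * δ α)), ?_, ?_, ?_⟩
  · exact sum_mem fun I _ => Submodule.smul_mem _ _ (complex_smul_mem_diffOps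
      (mul_mem_diffOps hx (multiOp_mem _) (deriv_mem hx _)) _)
  · simp [LinearMap.sum_apply, hx.apply_one]
  · rw [map_sum, Finset.sum_mul]
    refine Finset.sum_congr rfl fun I _ => ?_
    rw [eulerOp_smul, map_smul, ((hn I).commute α).eq, ((hn I).deriv_mul hx α).euler,
      inv_smul_smul₀ (by exact_mod_cast (n I).succ_ne_zero), ← ((hn I).commute α).eq]
    rfl

/-- The equations `[S, x^α] = E_α` are solvable by a differential operator `S` with `S 1 = 0` if
the `E_α` are differential operators that satisfy the integrability condition. -/
theorem exists_adCoord_eq (hx : IsCoordinates δ x) {E : Fin d → Module.End ℂ A} (hE : ∀ α, E α ∈ diffOps δ)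
    (hc : ∀ α β, adCoord x β (E α) = adCoord x α (E β)) :
    ∃ S ∈ diffOps δ, S 1 = 0 ∧ ∀ α, adCoord x α S = E α := by
  -- Any solution has Euler image $\sum_\alpha E_\alpha\delta_\alpha$; this single equation is
  -- solved, as with the homotopy operator of the Poincaré lemma.
  choose T hT hT1 hTE using fun α => exists_eulerOp_eq_mul_deriv hx (hE α) α
  have hS : ∑ α, T α ∈ diffOps δ := sum_mem fun α _ => hT α
  refine ⟨∑ α, T α, hS, by simp [LinearMap.sum_apply, hT1], fun β => ?_⟩
  -- By the integrability condition, $[S,x^\beta]$ and $E_\beta$ have the same image under Euler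
  -- operator plus identity, which is injective on differential operators.
  refine sub_eq_zero.1 (eq_zero_of_eulerOp_add_self hx (sub_mem (adCoord_mem hx hS β) (hE β)) ?_)
  have h1 : eulerOp δ x (∑ α, T α) = ∑ α, E α * δ α := by
    rw [map_sum]; simp only [hTE]
  have h2 := adCoord_eulerOp hx (∑ α, T α) β
  rw [h1, adCoord_sum_mul_deriv hx] at h2
  simp only [hc _ β] at h2
  rw [← eulerOp_apply (E β)] at h2
  rw [map_sub, sub_add_sub_comm, ← h2, sub_self]

end DiffOps

/-! ### The Moyal product and its behaviour on coordinates. -/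

section AbstractMoyal

open PowerSeries Finset

variable {A : Type*} [CommRing A] [Algebra ℂ A] {d : ℕ}
  {δ : Fin d → Module.End ℂ A} {x : Fin d → A} {J : Fin d → Fin d → ℂ} {M : ℕ → Bilin A}

/-- `M_k = (1/k!) (i/2)^k μ ∘ (∑ J_{ij} δ_i ⊗ δ_j)^k`, where `μ` is the multiplication of `A`. -/
structure IsMoyal (δ : Fin d → Module.End ℂ A) (J : Fin d → Fin d → ℂ) (M : ℕ → Bilin A) :
    Prop where
  zero : ∀ f g, M 0 f g = f * g
  succ : ∀ (k : ℕ) f g, ((k : ℂ) + 1) • M (k + 1) f g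
    = (Complex.I / 2) • ∑ i, ∑ j, J i j • M k (δ i f) (δ j g)

variable (δ J) in
/-- The operator `(i/2) ∑ ν, J_{αν} δ_ν`. -/
def hamOp (α : Fin d) : Module.End ℂ A := (Complex.I / 2) • ∑ ν, J α ν • δ ν

theorem hamOp_apply (α : Fin d) (f : A) :
    hamOp δ J α f = (Complex.I / 2) • ∑ ν, J α ν • δ ν f := by
  simp [hamOp, LinearMap.sum_apply]

theorem natCast_add_one_ne_zero (k : ℕ) : (k : ℂ) + 1 ≠ 0 := Nat.cast_add_one_ne_zero k

theorem eq_of_natCast_add_one_smul_eq {k : ℕ} {f g : A}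
    (h : ((k : ℂ) + 1) • f = ((k : ℂ) + 1) • g) : f = g :=
  smul_right_injective A (natCast_add_one_ne_zero k) h

theorem IsMoyal.succ_one_left (hM : IsMoyal δ J M) (hx : IsCoordinates δ x) (k : ℕ) (g : A) :
    M (k + 1) 1 g = 0 := by
  refine eq_of_natCast_add_one_smul_eq (k := k) ?_
  rw [hM.succ]
  simp [hx.apply_one]

theorem IsMoyal.map_left (hM : IsMoyal δ J M) (hx : IsCoordinates δ x) (k : ℕ) (ν : Fin d)
    (f g : A) : δ ν (M k f g) = M k (δ ν f) g + M k f (δ ν g) := by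
  induction k generalizing f g with
  | zero => rw [hM.zero, hM.zero, hM.zero, hx.leibniz]; ring
  | succ k ih =>
    refine eq_of_natCast_add_one_smul_eq (k := k) ?_
    rw [← map_smul, hM.succ, smul_add, hM.succ, hM.succ, ← smul_add, map_smul, map_sum,
      ← sum_add_distrib]
    congr 1
    refine sum_congr rfl fun i _ => ?_
    rw [map_sum, ← sum_add_distrib]
    refine sum_congr rfl fun j _ => ?_
    have h1 : δ ν (δ i f) = δ i (δ ν f) := LinearMap.congr_fun (hx.comm ν i) f
    have h2 : δ ν (δ j g) = δ j (δ ν g) := LinearMap.congr_fun (hx.comm ν j) g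
    rw [map_smul, ih, smul_add, h1, h2]

theorem IsMoyal.map_hamOp (hM : IsMoyal δ J M) (hx : IsCoordinates δ x) (k : ℕ) (α : Fin d)
    (f g : A) :
    hamOp δ J α (M k f g) = M k (hamOp δ J α f) g + M k f (hamOp δ J α g) := by
  simp only [hamOp_apply, map_smul, map_sum, LinearMap.smul_apply, LinearMap.sum_apply,
    hM.map_left hx, smul_add, sum_add_distrib]

theorem IsCoordinates.hamOp_coord_mul (hx : IsCoordinates δ x) (α β : Fin d) (f : A) :
    hamOp δ J α (x β * f) = x β * hamOp δ J α f + (Complex.I * J α β / 2) • f := by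
  simp only [hamOp_apply, hx.apply_coord_mul, smul_add, sum_add_distrib, mul_smul_comm, mul_sum,
    smul_ite, smul_zero, sum_ite_eq', mem_univ, if_true, smul_smul]
  congr 2
  ring

theorem IsCoordinates.hamOp_one (hx : IsCoordinates δ x) (α : Fin d) : hamOp δ J α 1 = 0 := by
  simp [hamOp_apply, hx.apply_one]

/-- With $P=\frac i2\sum J_{ij}\,\delta_i\otimes\delta_j$ and $H_\alpha$ = `hamOp δ J α`, one has
$[P,x_\alpha\otimes1]=1\otimes H_\alpha$, which commutes with $P$. Hence
$[P^{k+1}/(k+1)!,\,x_\alpha\otimes1]=(P^k/k!)(1\otimes H_\alpha)$. -/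
theorem IsMoyal.succ_coord_mul (hM : IsMoyal δ J M) (hx : IsCoordinates δ x) (k : ℕ)
    (α : Fin d) (f g : A) :
    M (k + 1) (x α * f) g = x α * M (k + 1) f g + M k f (hamOp δ J α g) := by
  have step : ∀ (k : ℕ) f g, ((k : ℂ) + 1) • M (k + 1) (x α * f) g
      = (Complex.I / 2) • (∑ i, ∑ j, J i j • M k (x α * δ i f) (δ j g))
        + M k f (hamOp δ J α g) := by
    intro k f g
    rw [hM.succ, hamOp_apply, map_smul, ← smul_add, map_sum]
    congr 1
    simp only [hx.apply_coord_mul, map_add, LinearMap.add_apply, smul_add, sum_add_distrib,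
      map_smul]
    congr 1
    rw [sum_eq_single α (fun i _ hi => by simp [hi]) (fun h => absurd (mem_univ α) h)]
    simp
  induction k generalizing f g with
  | zero =>
    refine eq_of_natCast_add_one_smul_eq (k := 0) ?_
    rw [step, smul_add, ← mul_smul_comm, hM.succ]
    simp [hM.zero, mul_sum, mul_assoc]
  | succ k ih =>
    refine eq_of_natCast_add_one_smul_eq (k := k + 1) ?_
    rw [step, smul_add, ← mul_smul_comm, hM.succ]
    simp only [ih, smul_add, sum_add_distrib, mul_sum, mul_smul_comm]
    rw [add_assoc]
    congr 1
    -- The induction hypothesis contributes $k+1$ copies of the last term and `step` one more, which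
    -- makes the factor $k+2$.
    have h : (Complex.I / 2) • ∑ i, ∑ j, J i j • M k (δ i f) (hamOp δ J α (δ j g))
        = ((k : ℂ) + 1) • M (k + 1) f (hamOp δ J α g) := by
      rw [hM.succ]
      congr 1
      refine sum_congr rfl fun i _ => sum_congr rfl fun j _ => ?_
      congr 2
      simp only [hamOp_apply, map_smul, map_sum]
      congr 1
      refine sum_congr rfl fun ν _ => ?_
      rw [show δ ν (δ j g) = δ j (δ ν g) from LinearMap.congr_fun (hx.comm ν j) g]
    rw [h]
    push_cast
    module

/-- Exchanging the tensor factors reverses the sign of the antisymmetric bidifferential operator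
whose $k$-th power defines $M_k$. -/
theorem IsMoyal.apply_swap (hM : IsMoyal δ J M) (hJ : ∀ i j, J i j = - J j i) (k : ℕ) (f g : A) :
    M k g f = (-1 : ℂ) ^ k • M k f g := by
  induction k generalizing f g with
  | zero => simp [hM.zero, mul_comm]
  | succ k ih =>
    refine eq_of_natCast_add_one_smul_eq (k := k) ?_
    rw [smul_comm, hM.succ, hM.succ, smul_comm, sum_comm]
    congr 1
    rw [smul_sum]
    refine sum_congr rfl fun i _ => ?_
    rw [smul_sum]
    refine sum_congr rfl fun j _ => ?_
    rw [ih, hJ j i, pow_succ]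
    module

theorem IsMoyal.apply_coord_one (hM : IsMoyal δ J M) (hx : IsCoordinates δ x) (α : Fin d)
    (g : A) : M 1 (x α) g = hamOp δ J α g := by
  have := hM.succ_coord_mul hx 0 α 1 g
  simpa [hM.succ_one_left hx, hM.zero] using this

theorem IsMoyal.apply_coord_add_two (hM : IsMoyal δ J M) (hx : IsCoordinates δ x) (k : ℕ)
    (α : Fin d) (g : A) : M (k + 2) (x α) g = 0 := by
  have := hM.succ_coord_mul hx (k + 1) α 1 g
  simpa [hM.succ_one_left hx] using this

theorem IsMoyal.starMul_coord (hM : IsMoyal δ J M) (hx : IsCoordinates δ x) (α : Fin d)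
    (f : A) : starMul M (C (x α)) (C f) = C (x α * f) + X * C (hamOp δ J α f) := by
  ext (_ | _ | m)
  · simp [coeff_starMul_C_C, hM.zero]
  · simp [coeff_starMul_C_C, hM.apply_coord_one hx]
  · rw [coeff_starMul_C_C, map_add, coeff_succ_X_mul, hM.apply_coord_add_two hx, coeff_C, coeff_C]
    simp

theorem IsMoyal.one_mul (hM : IsMoyal δ J M) (hx : IsCoordinates δ x) (F : PowerSeries A) :
    starMul M (C 1) F = F := by
  rw [starMul_C_left]
  refine (opMap_eq_smul (c := 1) (fun f => ?_) (fun k hk f => ?_) F).trans (one_smul _ _)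
  · simp [hM.zero]
  · obtain ⟨k, rfl⟩ := Nat.exists_eq_succ_of_ne_zero (by omega : k ≠ 0)
    exact hM.succ_one_left hx k f

/-- The first-order term is antisymmetric and the higher ones vanish on a coordinate. This is why
intertwiners obey the recurrence. -/
theorem IsMoyal.symMul_coord (hM : IsMoyal δ J M) (hx : IsCoordinates δ x)
    (hJ : ∀ i j, J i j = - J j i) (α : Fin d) (f : A) :
    symMul M (x α) (C f) = C (x α * f) := by
  ext m
  rw [symMul_apply, PowerSeries.coeff_smul, map_add, coeff_starMul_C_C, coeff_starMul_C_C,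
    hM.apply_swap hJ m (x α) f]
  rcases m with _ | _ | m
  · simp only [hM.zero, coeff_C, if_pos]
    module
  · simp
  · simp [hM.apply_coord_add_two hx]

/-- Associativity of the Moyal product if the first factor is a coordinate. -/
theorem IsMoyal.coord_mul_assoc (hM : IsMoyal δ J M) (hx : IsCoordinates δ x) (α : Fin d)
    (f g : A) : starMul M (starMul M (C (x α)) (C f)) (C g)
      = starMul M (C (x α)) (starMul M (C f) (C g)) := by
  rw [hM.starMul_coord hx, map_add, LinearMap.add_apply, starMul_X_mul_left]
  ext (_ | m)
  · rw [starMul_C_left M (x α), coeff_opMap]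
    simp [coeff_starMul_C_C, hM.zero, mul_assoc, coeff_zero_X_mul, -coeff_zero_eq_constantCoeff,
      -map_mul]
  · rw [starMul_C_left M (x α), coeff_opMap, Nat.sum_antidiagonal_succ]
    simp only [map_add, coeff_succ_X_mul, coeff_starMul_C_C, hM.zero, hM.succ_coord_mul hx]
    -- A coordinate meets only $M_0$ and $M_1$; what remains is that `hamOp` is a derivation of each
    -- $M_m$.
    rw [sum_eq_single (0, m)]
    · simp only [zero_add, hM.apply_coord_one hx, hM.map_hamOp hx]
      ring
    · rintro ⟨i, j⟩ hij hne
      rw [Finset.HasAntidiagonal.mem_antidiagonal] at hij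
      obtain ⟨i, rfl⟩ := Nat.exists_eq_succ_of_ne_zero (n := i)
        (by rintro rfl; exact hne (by simpa using hij))
      exact hM.apply_coord_add_two hx i α _
    · intro h; simp at h

theorem IsMoyal.apply_mem (hM : IsMoyal δ J M) (hx : IsCoordinates δ x) (k : ℕ) (f : A) :
    M k f ∈ diffOps δ := by
  induction k generalizing f with
  | zero =>
    have : M 0 f = LinearMap.mulLeft ℂ f := LinearMap.ext fun g => hM.zero f g
    rw [this]; exact mulLeft_mem_diffOps f
  | succ k ih =>
    have : M (k + 1) f = ((k : ℂ) + 1)⁻¹ • ((Complex.I / 2) •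
        ∑ i, ∑ j, J i j • (M k (δ i f) * δ j)) := by
      ext1 g
      rw [LinearMap.smul_apply, eq_inv_smul_iff₀ (natCast_add_one_ne_zero k), hM.succ]
      simp [LinearMap.sum_apply]
    rw [this]
    exact complex_smul_mem_diffOps (complex_smul_mem_diffOps (sum_mem fun i _ => sum_mem fun j _ =>
      complex_smul_mem_diffOps (mul_mem_diffOps hx (ih _) (deriv_mem hx _)) _) _) _

theorem IsMoyal.flip_apply_mem (hM : IsMoyal δ J M) (hx : IsCoordinates δ x)
    (hJ : ∀ i j, J i j = - J j i) (k : ℕ) (g : A) : (M k).flip g ∈ diffOps δ := by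
  have : (M k).flip g = (-1 : ℂ) ^ k • M k g :=
    LinearMap.ext fun f => hM.apply_swap hJ k g f
  rw [this]
  exact complex_smul_mem_diffOps (hM.apply_mem hx k g) _

end AbstractMoyal

/-! ### Solving the recurrence, and its equivalence with the intertwining property. -/

section AbstractEquivalence

open PowerSeries Finset

variable {A : Type*} [CommRing A] [Algebra ℂ A] {d : ℕ}
  {δ : Fin d → Module.End ℂ A} {x : Fin d → A} {J : Fin d → Fin d → ℂ} {M B : ℕ → Bilin A}

/-- A sequence of differential operators vanishes if its members annihilate `1` and its first
nonzero member would have to commute with the coordinates. -/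
theorem eq_zero_of_forall_lt (hx : IsCoordinates δ x) {V : ℕ → Module.End ℂ A}
    (hV : ∀ m, V m ∈ diffOps δ) (h1 : ∀ m, V m 1 = 0)
    (h : ∀ m, (∀ j < m, V j = 0) → ∀ α f, V m (x α * f) = x α * V m f) (m : ℕ) : V m = 0 := by
  induction m using Nat.strong_induction_on with
  | _ m ih =>
    refine eq_zero_of_adCoord_eq_zero hx (hV m) (fun α => ?_) (h1 m)
    ext1 f
    rw [adCoord_apply, h m ih, sub_self, LinearMap.zero_apply]

/-- `[S_k, x_α](f) = ½ ∑_{l=1}^k (B_l(x_α, S_{k-l} f) + B_l(S_{k-l} f, x_α))`. -/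
def RecurrenceAt (B : ℕ → Bilin A) (x : Fin d → A) (S : ℕ → Module.End ℂ A) (k : ℕ) : Prop :=
  ∀ α f, S k (x α * f) - x α * S k f
    = (1 / 2 : ℂ) • ∑ l ∈ Icc 1 k, (B l (x α) (S (k - l) f) + B l (S (k - l) f) (x α))

theorem recurrenceAt_zero {S : ℕ → Module.End ℂ A} (h0 : S 0 = LinearMap.id) :
    RecurrenceAt B x S 0 := by
  intro α f
  simp [h0]

theorem IsStar.recurrenceAt_iff (hB : IsStar B) {S : ℕ → Module.End ℂ A} {k : ℕ} :
    RecurrenceAt B x S k ↔ ∀ α f,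
      coeff k (opMap S (C (x α * f))) = coeff k (symMul B (x α) (opMap S (C f))) := by
  refine forall₂_congr fun α f => ?_
  rw [hB.coeff_symMul, sub_eq_iff_eq_add']
  simp only [coeff_opMap_C]

theorem IsStar.opMap_coord_mul (hB : IsStar B) {S : ℕ → Module.End ℂ A}
    (h : ∀ k, RecurrenceAt B x S k) (α : Fin d) (f : A) :
    opMap S (C (x α * f)) = symMul B (x α) (opMap S (C f)) := by
  ext k
  exact hB.recurrenceAt_iff.1 (h k) α f

/-- The recurrence determines a series of differential operators that annihilate `1`. -/
theorem eq_of_recurrenceAt (hx : IsCoordinates δ x) {S T : ℕ → Module.End ℂ A}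
    (hS0 : S 0 = LinearMap.id) (hT0 : T 0 = LinearMap.id)
    (hS : ∀ k, 1 ≤ k → S k ∈ diffOps δ) (hT : ∀ k, 1 ≤ k → T k ∈ diffOps δ)
    (hS1 : ∀ k, 1 ≤ k → S k 1 = 0) (hT1 : ∀ k, 1 ≤ k → T k 1 = 0)
    (hSr : ∀ k, 1 ≤ k → RecurrenceAt B x S k) (hTr : ∀ k, 1 ≤ k → RecurrenceAt B x T k) :
    T = S := by
  have key : ∀ m, T m - S m = 0 := by
    refine eq_zero_of_forall_lt (V := fun m => T m - S m) hx (fun m => ?_) (fun m => ?_)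
      (fun m hm α f => ?_)
    · rcases Nat.eq_zero_or_pos m with rfl | hm
      · simp [hS0, hT0]
      · exact sub_mem (hT m hm) (hS m hm)
    · rcases Nat.eq_zero_or_pos m with rfl | hm
      · simp [hS0, hT0]
      · simp [hT1 m hm, hS1 m hm]
    · rcases Nat.eq_zero_or_pos m with rfl | hm0
      · simp [hS0, hT0]
      · have h1 := hSr m hm0 α f
        have h2 := hTr m hm0 α f
        -- As $l\ge1$, the right-hand side at order $m$ sees only lower orders, where $S$ and $T$
        -- agree.
        have h3 : ∀ l ∈ Icc 1 m, B l (x α) (T (m - l) f) + B l (T (m - l) f) (x α)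
            = B l (x α) (S (m - l) f) + B l (S (m - l) f) (x α) := by
          intro l hl
          rw [mem_Icc] at hl
          rw [sub_eq_zero.1 (hm (m - l) (by omega))]
        rw [sum_congr rfl h3, ← h1] at h2
        simp only [LinearMap.sub_apply]
        linear_combination h2
  funext m
  exact sub_eq_zero.1 (key m)

/-- Integrability of the recurrence. -/
theorem IsStar.recurrence_integrable (hB : IsStar B)
    (hc : ∀ α β, HasScalarCommutator B (x α) (x β) (Complex.I * J α β))
    {S : ℕ → Module.End ℂ A} {k : ℕ} (hlt : ∀ j < k, RecurrenceAt B x S j) (hk : S k = 0)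
    (α β : Fin d) (f : A) :
    coeff k (symMul B (x β) (opMap S (C (x α * f))))
        + x β * coeff k (symMul B (x α) (opMap S (C f)))
      = coeff k (symMul B (x α) (opMap S (C (x β * f))))
        + x α * coeff k (symMul B (x β) (opMap S (C f))) := by
  have key : ∀ α β, coeff k (symMul B (x β) (symMul B (x α) (opMap S (C f))))
      = coeff k (symMul B (x β) (opMap S (C (x α * f))))
        + x β * coeff k (symMul B (x α) (opMap S (C f))) := by
    intro α β
    -- The lower recurrences make the error $O(\hbar^k)$, so at order $k$ the operator `symMul B (x
    -- β)` acts on it as ordinary multiplication by $x_\beta$.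
    obtain ⟨H, hH⟩ : X ^ k ∣ symMul B (x α) (opMap S (C f)) - opMap S (C (x α * f)) := by
      refine X_pow_dvd_iff.2 fun j hj => ?_
      rw [map_sub, hB.recurrenceAt_iff.1 (hlt j hj), sub_self]
    have h0 : coeff k (symMul B (x α) (opMap S (C f))) = coeff 0 H := by
      have := congrArg (coeff (0 + k)) hH
      rw [coeff_X_pow_mul, zero_add, map_sub, coeff_opMap_C, hk] at this
      simpa using this
    rw [h0, eq_add_of_sub_eq' hH, map_add, map_add, symMul_X_pow_mul]
    congr 1
    have h1 := coeff_X_pow_mul (symMul B (x β) H) k 0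
    rw [zero_add] at h1
    rw [h1, hB.coeff_symMul]
    simp
  rw [← key α β, ← key β α, hB.symMul_comm (hc β α)]

/-- Strong recursion. -/
def strongSeq {E : Type*} [Zero E] (Φ : ℕ → (ℕ → E) → E) : ℕ → E
  | k => Φ k fun j => if _h : j < k then strongSeq Φ j else 0

theorem strongSeq_eq {E : Type*} [Zero E] (Φ : ℕ → (ℕ → E) → E) (k : ℕ) :
    strongSeq Φ k = Φ k fun j => if j < k then strongSeq Φ j else 0 := by
  rw [strongSeq]
  simp

/-- The recurrence has a solution in differential operators that annihilate `1`. -/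
theorem IsStar.exists_recurrence (hx : IsCoordinates δ x) (hB : IsStar B)
    (hBl : ∀ k f, B k f ∈ diffOps δ) (hBr : ∀ k g, (B k).flip g ∈ diffOps δ)
    (hc : ∀ α β, HasScalarCommutator B (x α) (x β) (Complex.I * J α β)) :
    ∃ S : ℕ → Module.End ℂ A, S 0 = LinearMap.id ∧ (∀ k, S k ∈ diffOps δ) ∧
      (∀ k, 1 ≤ k → S k 1 = 0) ∧ ∀ k, RecurrenceAt B x S k := by
  classical
  let Good : ℕ → (ℕ → Module.End ℂ A) → Module.End ℂ A → Prop := fun k T D =>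
    D ∈ diffOps δ ∧ D 1 = 0 ∧ ∀ α f, D (x α * f) - x α * D f
      = (1 / 2 : ℂ) • ∑ l ∈ Icc 1 k, (B l (x α) (T (k - l) f) + B l (T (k - l) f) (x α))
  -- The default $0$ only makes the recursion total: `hex` below shows that an operator as required
  -- exists at every order.
  let Φ : ℕ → (ℕ → Module.End ℂ A) → Module.End ℂ A := fun k T =>
    if k = 0 then LinearMap.id else if h : ∃ D, Good k T D then h.choose else 0
  have hΦ : ∀ k T, k ≠ 0 → (∃ D, Good k T D) → Good k T (Φ k T) := by
    intro k T hk h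
    simp only [Φ, if_neg hk, dif_pos h]
    exact h.choose_spec
  let S := strongSeq Φ
  have hS0 : S 0 = LinearMap.id := by
    change strongSeq Φ 0 = _
    rw [strongSeq_eq]
    simp [Φ]
  have key : ∀ k, S k ∈ diffOps δ ∧ (1 ≤ k → S k 1 = 0) ∧ RecurrenceAt B x S k := by
    intro k
    induction k using Nat.strong_induction_on with
    | _ k ih =>
      rcases Nat.eq_zero_or_pos k with rfl | hk
      · refine ⟨?_, by omega, recurrenceAt_zero hS0⟩
        rw [hS0]; exact one_mem_diffOps
      -- With $T_k=0$ the $l=0$ term drops out, so the order-$k$ coefficient of the symmetrized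
      -- product is exactly $E_\alpha f$; compare `hE'`.
      let T : ℕ → Module.End ℂ A := fun j => if j < k then S j else 0
      have hT : ∀ j < k, T j = S j := fun j hj => if_pos hj
      have hTk : T k = 0 := if_neg (lt_irrefl k)
      have hTmem : ∀ j, T j ∈ diffOps δ := by
        intro j
        by_cases hj : j < k
        · rw [hT j hj]; exact (ih j hj).1
        · have : T j = 0 := if_neg hj
          rw [this]; exact zero_mem _
      have hTr : ∀ j < k, RecurrenceAt B x T j := by
        intro j hj α f
        have h := (ih j hj).2.2 α f
        rw [hT j hj, h]
        congr 1
        exact sum_congr rfl fun l _ => by rw [hT (j - l) (by omega)]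
      let E : Fin d → Module.End ℂ A := fun α =>
        (1 / 2 : ℂ) • ∑ l ∈ Icc 1 k, (B l (x α) + (B l).flip (x α)) * T (k - l)
      have hE : ∀ α f, E α f = (1 / 2 : ℂ) • ∑ l ∈ Icc 1 k,
          (B l (x α) (T (k - l) f) + B l (T (k - l) f) (x α)) := by
        intro α f
        simp [E, LinearMap.sum_apply]
      have hE' : ∀ α f, E α f = coeff k (symMul B (x α) (opMap T (C f))) := by
        intro α f
        rw [hB.coeff_symMul, coeff_opMap_C, hTk, hE]
        simp [coeff_opMap_C]
      have hex : ∃ D, Good k T D := by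
        obtain ⟨D, hD, hD1, hDE⟩ := exists_adCoord_eq hx (E := E)
          (fun α => complex_smul_mem_diffOps (sum_mem fun l _ =>
            mul_mem_diffOps hx (add_mem (hBl _ _) (hBr _ _)) (hTmem _)) _)
          (fun α β => by
            ext1 f
            have h := hB.recurrence_integrable hc hTr hTk α β f
            simp only [← hE'] at h
            rw [adCoord_apply, adCoord_apply]
            linear_combination -h)
        exact ⟨D, hD, hD1, fun α f => by rw [← hE, ← hDE, adCoord_apply]⟩
      have hgood := hΦ k T hk.ne' hex
      have hSk : S k = Φ k T := strongSeq_eq Φ k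
      rw [← hSk] at hgood
      refine ⟨hgood.1, fun _ => hgood.2.1, fun α f => ?_⟩
      rw [hgood.2.2 α f]
      congr 1
      refine sum_congr rfl fun l hl => ?_
      rw [mem_Icc] at hl
      rw [hT (k - l) (by omega)]
  exact ⟨S, hS0, fun k => (key k).1, fun k => (key k).2.1, fun k => (key k).2.2⟩

theorem opMap_C_one {S : ℕ → Module.End ℂ A} (h0 : S 0 = LinearMap.id)
    (h1 : ∀ k, 1 ≤ k → S k 1 = 0) : opMap S (C 1) = C 1 := by
  ext (_ | m)
  · rw [coeff_opMap_C, h0, coeff_C]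
    simp
  · rw [coeff_opMap_C, h1 _ (by omega), coeff_C, if_neg (by omega)]

theorem IsStar.opMap_coord (hB : IsStar B) {S : ℕ → Module.End ℂ A}
    (h0 : S 0 = LinearMap.id) (h1 : ∀ k, 1 ≤ k → S k 1 = 0)
    (hr : ∀ k, RecurrenceAt B x S k) (α : Fin d) : opMap S (C (x α)) = C (x α) := by
  have h := hB.opMap_coord_mul hr α 1
  rw [_root_.mul_one, opMap_C_one h0 h1, symMul_apply, hB.mul_one, hB.one_mul] at h
  rw [h]
  module

/-- At the lowest order present in $F$ only $B_0$ contributes. This makes the first nonzero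
coefficient of a defect commute with the coordinates. -/
theorem coeff_symMul_of_forall_lt (hB : IsStar B) {f : A} {F : PowerSeries A} {m : ℕ}
    (h : ∀ j < m, coeff j F = 0) : coeff m (symMul B f F) = f * coeff m F := by
  rw [hB.coeff_symMul, sum_eq_zero, smul_zero, add_zero]
  intro l hl
  rw [mem_Icc] at hl
  rw [h (m - l) (by omega)]
  simp

theorem coeff_starMul_C_of_forall_lt (hB : IsStar B) {f : A} {F : PowerSeries A} {m : ℕ}
    (h : ∀ j < m, coeff j F = 0) : coeff m (starMul B (C f) F) = f * coeff m F := by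
  rw [starMul_C_left, coeff_opMap, sum_eq_single (0, m)]
  · rw [hB.zero]
  · rintro ⟨i, j⟩ hij hne
    rw [Finset.HasAntidiagonal.mem_antidiagonal] at hij
    have : i ≠ 0 := by rintro rfl; exact hne (by simpa using hij)
    simp only at hij ⊢
    rw [h j (by omega), map_zero]
  · intro h; simp at h

/-- A solution of the recurrence intertwines the left multiplications by coordinates. -/
theorem IsStar.opMap_leftMul_coord (hx : IsCoordinates δ x) (hB : IsStar B)
    (hBl : ∀ k f, B k f ∈ diffOps δ)
    (hc : ∀ α β, HasScalarCommutator B (x α) (x β) (Complex.I * J α β)) (hM : IsMoyal δ J M)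
    {S : ℕ → Module.End ℂ A} (h0 : S 0 = LinearMap.id) (hS : ∀ k, S k ∈ diffOps δ)
    (h1 : ∀ k, 1 ≤ k → S k 1 = 0) (hr : ∀ k, RecurrenceAt B x S k) (α : Fin d)
    (F : PowerSeries A) :
    opMap S (starMul M (C (x α)) F) = starMul B (C (x α)) (opMap S F) := by
  let W : A → PowerSeries A := fun f =>
    starMul B (C (x α)) (opMap S (C f)) - opMap S (starMul M (C (x α)) (C f))
  let V : ℕ → Module.End ℂ A := fun m =>
    ∑ a ∈ antidiagonal m, (B a.1 (x α) * S a.2 - S a.1 * M a.2 (x α))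
  have hVW : ∀ m f, V m f = coeff m (W f) := by
    intro m f
    simp only [W, V, map_sub, starMul_C_left B, LinearMap.sum_apply, sum_sub_distrib,
      LinearMap.sub_apply]
    rw [coeff_opMap, coeff_opMap]
    simp [coeff_opMap_C, coeff_starMul_C_C]
  -- Commuting left multiplication by $x_\alpha$ past the symmetrized one by $x_\beta$ costs
  -- $\frac{i\hbar}2J_{\alpha\beta}$ for both products, so these terms cancel in the defect.
  have hW : ∀ β f, W (x β * f) = symMul B (x β) (W f) := by
    intro β f
    have e1 : opMap S (starMul M (C (x α)) (C (x β * f)))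
        = symMul B (x β) (opMap S (starMul M (C (x α)) (C f)))
          + (Complex.I * J α β / 2) • (X * opMap S (C f)) := by
      have e2 : (C (x β * hamOp δ J α f + (Complex.I * J α β / 2) • f) : PowerSeries A)
          = C (x β * hamOp δ J α f) + (Complex.I * J α β / 2) • C f := by
        ext (_ | m) <;> simp
      rw [hM.starMul_coord hx, hM.starMul_coord hx, hx.hamOp_coord_mul, e2, mul_left_comm]
      simp only [mul_add, X_mul_smul, map_add, map_smul, opMap_X_mul, hB.opMap_coord_mul hr,
        symMul_X_mul]
      abel
    simp only [W]
    rw [e1, hB.opMap_coord_mul hr, hB.leftMul_symMul (hc α β), map_sub]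
    abel
  have hV0 : ∀ m, V m = 0 := by
    refine eq_zero_of_forall_lt hx (fun m => ?_) (fun m => ?_) (fun m hm β f => ?_)
    · exact sum_mem fun a _ => sub_mem (mul_mem_diffOps hx (hBl _ _) (hS _))
        (mul_mem_diffOps hx (hS _) (hM.apply_mem hx _ _))
    · rw [hVW]
      simp only [W]
      rw [opMap_C_one h0 h1, hB.mul_one, hM.starMul_coord hx, hx.hamOp_one, _root_.mul_one, map_zero,
        mul_zero, add_zero, hB.opMap_coord h0 h1 hr, sub_self, map_zero]
    · rw [hVW, hVW, hW]
      exact coeff_symMul_of_forall_lt hB fun j hj => by rw [← hVW, hm j hj, LinearMap.zero_apply]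
  have := ext_of_C (V := (opMap S).comp (starMul M (C (x α))))
    (W := (starMul B (C (x α))).comp (opMap S))
    (fun F => by simp [starMul_X_mul_right, opMap_X_mul])
    (fun F => by simp [starMul_X_mul_right, opMap_X_mul])
    (fun f => by
      ext m
      have h := hVW m f
      rw [hV0 m, LinearMap.zero_apply, map_sub] at h
      exact (sub_eq_zero.1 h.symm).symm)
  exact LinearMap.congr_fun this F

/-- A solution of the recurrence intertwines the Moyal product with the given star product. -/
theorem IsStar.opMap_starMul (hx : IsCoordinates δ x) (hB : IsStar B)
    (hBl : ∀ k f, B k f ∈ diffOps δ) (hBr : ∀ k g, (B k).flip g ∈ diffOps δ)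
    (hc : ∀ α β, HasScalarCommutator B (x α) (x β) (Complex.I * J α β)) (hM : IsMoyal δ J M)
    (hJ : ∀ i j, J i j = - J j i)
    {S : ℕ → Module.End ℂ A} (h0 : S 0 = LinearMap.id) (hS : ∀ k, S k ∈ diffOps δ)
    (h1 : ∀ k, 1 ≤ k → S k 1 = 0) (hr : ∀ k, RecurrenceAt B x S k) (F G : PowerSeries A) :
    opMap S (starMul M F G) = starMul B (opMap S F) (opMap S G) := by
  have hL := hB.opMap_leftMul_coord hx hBl hc hM h0 hS h1 hr
  have key : ∀ f g, opMap S (starMul M (C f) (C g))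
      = starMul B (opMap S (C f)) (opMap S (C g)) := by
    intro f g
    let N : PowerSeries A →ₗ[ℂ] PowerSeries A := opMap S ∘ₗ (starMul M).flip (C g)
      - (starMul B).flip (opMap S (C g)) ∘ₗ opMap S
    have hN : ∀ F, N F = opMap S (starMul M F (C g)) - starMul B (opMap S F) (opMap S (C g)) :=
      fun F => rfl
    have hNX : ∀ F, N (X * F) = X * N F := by
      intro F
      simp only [hN, starMul_X_mul_left, opMap_X_mul, mul_sub]
    let V : ℕ → Module.End ℂ A := fun m =>
      ∑ a ∈ antidiagonal m, (S a.1 * (M a.2).flip g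
        - ∑ b ∈ antidiagonal a.2, (B a.1).flip (S b.2 g) * S b.1)
    have hVN : ∀ m f, V m f = coeff m (N (C f)) := by
      intro m f
      rw [hN, map_sub, coeff_starMul, coeff_opMap]
      simp [V, LinearMap.sum_apply, coeff_opMap_C, coeff_starMul_C_C]
    -- In the Moyal product $x_\alpha f=x_\alpha\star_M f-\hbar H_\alpha f$, with $H_\alpha$ =
    -- `hamOp δ J α`, and $N$ intertwines the left multiplications by $x_\alpha$. The correction
    -- carries an extra $\hbar$, so it involves only lower coefficients of $N$.
    have hNL : ∀ α f, N (C (x α * f))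
        = starMul B (C (x α)) (N (C f)) - X * N (C (hamOp δ J α f)) := by
      intro α f
      rw [eq_sub_iff_add_eq, ← hNX, ← map_add, ← hM.starMul_coord hx, hN, hN,
        hM.coord_mul_assoc hx, hL, hL, hB.mul_assoc, map_sub]
    have hV0 : ∀ m, V m = 0 := by
      refine eq_zero_of_forall_lt hx (fun m => ?_) (fun m => ?_) (fun m hm β f => ?_)
      · exact sum_mem fun a _ => sub_mem (mul_mem_diffOps hx (hS _) (hM.flip_apply_mem hx hJ _ _))
          (sum_mem fun b _ => mul_mem_diffOps hx (hBr _ _) (hS _))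
      · rw [hVN, hN, hM.one_mul hx, opMap_C_one h0 h1, hB.one_mul, sub_self, map_zero]
      · rw [hVN, hVN, hNL, map_sub, coeff_starMul_C_of_forall_lt hB
          (fun j hj => by rw [← hVN, hm j hj, LinearMap.zero_apply])]
        rcases m with _ | m
        · simp
        · rw [coeff_succ_X_mul, ← hVN m, hm m (Nat.lt_succ_self m), LinearMap.zero_apply, sub_zero]
    ext m
    have h := hVN m f
    rw [hV0 m, LinearMap.zero_apply, hN, map_sub] at h
    exact sub_eq_zero.1 h.symm
  have := ext_of_C₂ (V := (starMul M).compr₂ (opMap S))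
    (W := (starMul B).compl₁₂ (opMap S) (opMap S))
    (fun F G => by simp [starMul_X_mul_left, opMap_X_mul])
    (fun F G => by simp [starMul_X_mul_right, opMap_X_mul])
    (fun F G => by simp [starMul_X_mul_left, opMap_X_mul])
    (fun F G => by simp [starMul_X_mul_right, opMap_X_mul])
    (fun f g => by simpa using key f g)
  exact LinearMap.congr_fun₂ this F G

/-- An intertwiner with leading term the identity preserves `1`. -/
theorem IsStar.opMap_one_of_intertwines (hx : IsCoordinates δ x) (hB : IsStar B)
    (hM : IsMoyal δ J M) {T : ℕ → Module.End ℂ A} (h0 : T 0 = LinearMap.id)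
    (hT : ∀ F G, opMap T (starMul M F G) = starMul B (opMap T F) (opMap T G)) :
    opMap T (C 1) = C 1 := by
  have hu := hT (C 1) (C 1)
  rw [hM.one_mul hx] at hu
  set v := opMap T (C 1) - C 1 with hv
  have hv0 : coeff 0 v = 0 := by
    rw [hv, map_sub, coeff_opMap_C, h0]
    simp
  -- Expanding the idempotent relation for $1+v$ gives this. As $\hbar$ divides $v$, the power of
  -- $\hbar$ dividing $v$ can be raised indefinitely.
  have hvv : v = - starMul B v v := by
    have : starMul B v v = starMul B (opMap T (C 1)) (opMap T (C 1)) - opMap T (C 1)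
        - opMap T (C 1) + C 1 := by
      simp only [hv, map_sub, LinearMap.sub_apply, hB.mul_one, hB.one_mul]
      abel
    rw [this, ← hu, hv]
    abel
  obtain ⟨H, hH⟩ : X ∣ v := X_dvd_iff.2 (by simpa using hv0)
  have key : ∀ k : ℕ, X ^ k ∣ v := by
    intro k
    induction k with
    | zero => simp
    | succ k ih =>
      obtain ⟨K, hK⟩ := ih
      have hstar : ∀ k G K, starMul B G (X ^ k * K) = X ^ k * starMul B G K := by
        intro k G K
        induction k with
        | zero => simp
        | succ k ih => rw [pow_succ', _root_.mul_assoc, starMul_X_mul_right, ih, _root_.mul_assoc]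
      have h2 : starMul B v v = X ^ (k + 1) * starMul B H K := by
        conv_lhs => rw [hK]
        rw [hstar, ← hK, hH, starMul_X_mul_left, pow_succ, _root_.mul_assoc]
      rw [hvv, h2]
      exact (Dvd.intro _ rfl).neg_right
  have : v = 0 := by
    ext m
    exact X_pow_dvd_iff.1 (key (m + 1)) m (Nat.lt_succ_self m)
  exact sub_eq_zero.1 this

/-- An intertwiner that fixes the coordinates satisfies the recurrence. -/
theorem IsStar.recurrenceAt_of_intertwines (hx : IsCoordinates δ x) (hB : IsStar B)
    (hM : IsMoyal δ J M) (hJ : ∀ i j, J i j = - J j i) {T : ℕ → Module.End ℂ A}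
    (hT : ∀ F G, opMap T (starMul M F G) = starMul B (opMap T F) (opMap T G))
    (hTx : ∀ α, opMap T (C (x α)) = C (x α)) (k : ℕ) : RecurrenceAt B x T k := by
  refine hB.recurrenceAt_iff.2 fun α f => ?_
  -- The ordinary product $x_\alpha f$ is rewritten as a symmetrized Moyal product, to which the
  -- morphism property applies.
  rw [← hM.symMul_coord hx hJ, symMul_apply, symMul_apply, map_smul, map_add, hT, hT, hTx]

end AbstractEquivalence

/-! ### The concrete operators on $C^\infty(U)$ as instances of the abstract setting. -/

section Coordinates

variable {d : ℕ} {U : TopologicalSpace.Opens (Eucl d)}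

variable (U) in
theorem isCoordinates_pderiv : IsCoordinates (pderiv U) (coordFn U) :=
  ⟨pderiv_mul, fun i j => LinearMap.ext fun f => pderiv_comm i j f, pderiv_coordFn⟩

theorem isDiffOp_iff_mem {D : Module.End ℂ (CInf U)} : IsDiffOp D ↔ D ∈ diffOps (pderiv U) := by
  rw [mem_diffOps_iff]
  refine exists_congr fun s => exists_congr fun c => ?_
  rw [LinearMap.ext_iff]
  simp [LinearMap.sum_apply, multiOp, pderivMulti]

theorem IsBidiffOp.apply_left_mem {B : Bilin (CInf U)} (hB : IsBidiffOp B) (f : CInf U) :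
    B f ∈ diffOps (pderiv U) := by
  obtain ⟨s, c, hB⟩ := hB
  have : B f = ∑ IJ ∈ s, (c IJ * pderivMulti U IJ.1 f) • multiOp (pderiv U) IJ.2 := by
    ext1 g
    simp [hB, LinearMap.sum_apply, mul_assoc, multiOp, pderivMulti]
  rw [this]
  exact sum_mem fun IJ _ => Submodule.smul_mem _ _ (multiOp_mem _)

theorem IsBidiffOp.flip_apply_mem {B : Bilin (CInf U)} (hB : IsBidiffOp B) (g : CInf U) :
    B.flip g ∈ diffOps (pderiv U) := by
  obtain ⟨s, c, hB⟩ := hB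
  have : B.flip g = ∑ IJ ∈ s, (c IJ * pderivMulti U IJ.2 g) • multiOp (pderiv U) IJ.1 := by
    ext1 f
    simp only [LinearMap.flip_apply, hB, LinearMap.sum_apply, LinearMap.smul_apply, smul_eq_mul]
    exact Finset.sum_congr rfl fun IJ _ => by rw [multiOp, pderivMulti, pderivMulti]; ring
  rw [this]
  exact sum_mem fun IJ _ => Submodule.smul_mem _ _ (multiOp_mem _)

theorem canonicalMatrix_antisymm (d n : ℕ) (i j : Fin d) :
    canonicalMatrix d n i j = - canonicalMatrix d n j i := by
  unfold canonicalMatrix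
  split_ifs <;> first | omega | simp

theorem pderivWord_snoc {r : ℕ} (w : Fin r → Fin d) (i : Fin d) (f : CInf U) :
    pderivWord U (Fin.snoc w i : Fin (r + 1) → Fin d) f = pderivWord U w (pderiv U i f) := by
  rw [pderivWord, List.ofFn_succ']
  simp [pderivWord, -List.ofFn_succ]

theorem sum_pi_snoc {E : Type*} [AddCommMonoid E] {r : ℕ} (F : (Fin (r + 1) → Fin d) → E) :
    ∑ w, F w = ∑ i, ∑ w : Fin r → Fin d, F (Fin.snoc w i : Fin (r + 1) → Fin d) := by
  rw [← (Fin.snocEquiv fun _ : Fin (r + 1) => Fin d).sum_comp, Fintype.sum_prod_type]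
  rfl

theorem moyal_apply (n k : ℕ) (f g : CInf U) :
    moyal U n k f g = ((1 / (k.factorial : ℂ)) * (Complex.I / 2) ^ k) •
      ∑ μ : Fin k → Fin d, ∑ ν : Fin k → Fin d,
        (∏ j, (canonicalMatrix d n (μ j) (ν j) : ℂ)) • (pderivWord U μ f * pderivWord U ν g) := by
  simp [moyal, LinearMap.sum_apply]

-- Splitting off the last pair of indices moves one derivative onto each argument; the prefactors
-- match through $(k+1)/(k+1)!=1/k!$.
variable (U) in
theorem isMoyal_moyal (n : ℕ) :
    IsMoyal (pderiv U) (fun i j => (canonicalMatrix d n i j : ℂ)) (moyal U n) where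
  zero f g := by
    rw [moyal_apply]
    simp [pderivWord]
  succ k f g := by
    have hk : ((k : ℂ) + 1) * ((1 / ((k + 1).factorial : ℂ)) * (Complex.I / 2) ^ (k + 1))
        = (Complex.I / 2) * ((1 / (k.factorial : ℂ)) * (Complex.I / 2) ^ k) := by
      have h1 : (k : ℂ) + 1 ≠ 0 := Nat.cast_add_one_ne_zero k
      have h2 : (k.factorial : ℂ) ≠ 0 := by exact_mod_cast k.factorial_ne_zero
      rw [Nat.factorial_succ]
      push_cast
      field_simp
      ring
    simp only [moyal_apply]
    rw [smul_smul, hk, ← smul_smul]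
    congr 1
    rw [sum_pi_snoc, Finset.smul_sum]
    refine Finset.sum_congr rfl fun i _ => ?_
    simp only [sum_pi_snoc (d := d) (r := k), Finset.smul_sum]
    rw [Finset.sum_comm]
    refine Finset.sum_congr rfl fun j _ => Finset.sum_congr rfl fun μ _ =>
      Finset.sum_congr rfl fun ν _ => ?_
    rw [pderivWord_snoc, pderivWord_snoc, Fin.prod_univ_castSucc]
    simp only [Fin.snoc_castSucc, Fin.snoc_last, smul_smul]
    congr 1
    ring

end Coordinates

/-! ### Transfer of the star-product axioms from $M$ to $U$. -/

section Manifold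

variable {d : ℕ} {M : Type*} [TopologicalSpace M] [ChartedSpace (Eucl d) M]
  [IsManifold (𝓡 d) ∞ M]

/-- On a Hausdorff manifold, every germ of a smooth function on the image of a coordinate system
is the germ of the restriction of a global smooth function. -/
theorem exists_restrict_eventuallyEq [T2Space M] (x : CoordSystem d M) (f : CInf x.image)
    (y : x.image) :
    ∃ F : SmoothFn d M, ext0 (x.restrict F).1 =ᶠ[nhds (y : Eucl d)] ext0 f.1 := by
  have hy : (y : Eucl d) ∈ x.1.target := y.2
  set p : M := x.1.symm y with hp
  have hps : p ∈ x.1.source := x.1.map_target hy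
  -- The closed support of $\chi$ lies in the chart domain, so values of the chart outside that
  -- domain do not affect smoothness.
  obtain ⟨χ, hχ, -⟩ := (SmoothBumpFunction.nhds_basis_support (I := 𝓡 d)
    (x.1.open_source.mem_nhds hps)).mem_iff.1 (x.1.open_source.mem_nhds hps)
  have hsmooth : ContMDiff (𝓡 d) 𝓘(ℝ, ℂ) ∞ fun q => χ q • ext0 f.1 (x.1 q) := by
    refine contMDiff_of_tsupport fun q hq => ?_
    have hqs : q ∈ x.1.source := hχ (tsupport_smul_subset_left _ _ hq)
    have hfx : ContMDiffAt (𝓡 d) 𝓘(ℝ, ℂ) ∞ (fun q => ext0 f.1 (x.1 q)) q := by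
      have h1 : ContMDiffAt (𝓡 d) (𝓡 d) ∞ x.1 q :=
        contMDiffAt_of_mem_maximalAtlas x.2 hqs
      have h2 : ContDiffAt ℝ ∞ (ext0 f.1) (x.1 q) :=
        ext0_contDiffAt f ⟨x.1 q, x.1.map_source hqs⟩
      exact h2.contMDiffAt.comp q h1
    exact χ.contMDiffAt.smul hfx
  refine ⟨⟨_, hsmooth⟩, ?_⟩
  have hone : ∀ᶠ z in nhds (y : Eucl d), χ (x.1.symm z) = 1 :=
    (x.1.continuousAt_symm hy).eventually χ.eventuallyEq_one
  filter_upwards [hone, x.1.open_target.mem_nhds hy] with z hz hzt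
  rw [ext0_apply (x.restrict ⟨_, hsmooth⟩).1 ⟨z, hzt⟩]
  change χ (x.1.symm z) • ext0 f.1 (x.1 (x.1.symm z)) = _
  rw [hz, one_smul, x.1.right_inv hzt]

theorem StarProduct.isBidiffOp_coeffIn {P : PoissonTensor d M} (star : StarProduct P)
    (x : CoordSystem d M) (k : ℕ) : IsBidiffOp (star.coeffIn x k) :=
  (star.bidiff k x).choose_spec.1

theorem StarProduct.coeffIn_restrict {P : PoissonTensor d M} (star : StarProduct P)
    (x : CoordSystem d M) (k : ℕ) (f g : SmoothFn d M) :
    star.coeffIn x k (x.restrict f) (x.restrict g) = x.restrict (star.C k f g) :=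
  ((star.bidiff k x).choose_spec.2 f g).symm

/-- The coefficients of a star product in a coordinate system satisfy the axioms of a star
product. -/
theorem StarProduct.isStar_coeffIn [T2Space M] {P : PoissonTensor d M} (star : StarProduct P)
    (x : CoordSystem d M) : IsStar (star.coeffIn x) := by
  have hb := star.isBidiffOp_coeffIn x
  have value : ∀ {f g : CInf x.image} {y : x.image},
      ext0 f.1 =ᶠ[nhds (y : Eucl d)] ext0 g.1 → f.1 y = g.1 y := by
    intro f g y h
    simpa only [ext0_apply] using h.eq_of_nhds
  -- Each axiom is checked at a point, with the arguments replaced by restrictions of global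
  -- functions having the same germs. Working with germs allows nested applications, as in
  -- associativity.
  have germ : ∀ k {f g : CInf x.image} {F G : SmoothFn d M} {y : x.image},
      ext0 (x.restrict F).1 =ᶠ[nhds (y : Eucl d)] ext0 f.1 →
      ext0 (x.restrict G).1 =ᶠ[nhds (y : Eucl d)] ext0 g.1 →
      ext0 (x.restrict (star.C k F G)).1 =ᶠ[nhds (y : Eucl d)]
        ext0 (star.coeffIn x k f g).1 := by
    intro k f g F G y hF hG
    rw [← star.coeffIn_restrict]
    exact (hb k).congr_germ hF hG
  have restrict_one : x.restrict 1 = 1 := rfl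
  refine ⟨fun f g => ?_, fun k f g h => ?_, fun k hk f => ?_, fun k hk f => ?_⟩
  · ext y
    obtain ⟨F, hF⟩ := exists_restrict_eventuallyEq x f y
    obtain ⟨G, hG⟩ := exists_restrict_eventuallyEq x g y
    have h0 := value (germ 0 hF hG)
    rw [star.zero] at h0
    rw [← h0]
    change (x.restrict F).1 y * (x.restrict G).1 y = f.1 y * g.1 y
    rw [value hF, value hG]
  · ext y
    obtain ⟨F, hF⟩ := exists_restrict_eventuallyEq x f y
    obtain ⟨G, hG⟩ := exists_restrict_eventuallyEq x g y
    obtain ⟨H, hH⟩ := exists_restrict_eventuallyEq x h y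
    have hs := congrArg (fun φ : SmoothFn d M => φ.1 (x.1.symm y)) (star.assoc k F G H)
    have hterm : ∀ a : ℕ × ℕ,
        (star.coeffIn x a.1 (star.coeffIn x a.2 f g) h
          - star.coeffIn x a.1 f (star.coeffIn x a.2 g h)).1 y
        = (star.C a.1 (star.C a.2 F G) H - star.C a.1 F (star.C a.2 G H)).1 (x.1.symm y) := by
      intro a
      have h1 := value (germ a.1 (germ a.2 hF hG) hH)
      have h2 := value (germ a.1 hF (germ a.2 hG hH))
      change (star.coeffIn x a.1 (star.coeffIn x a.2 f g) h).1 y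
        - (star.coeffIn x a.1 f (star.coeffIn x a.2 g h)).1 y = _
      rw [← h1, ← h2]
      rfl
    have hsumU : ∀ (s : Finset (ℕ × ℕ)) (φ : ℕ × ℕ → CInf x.image),
        (∑ a ∈ s, φ a).1 y = ∑ a ∈ s, (φ a).1 y := by
      intro s φ
      simp [Finset.sum_apply]
    have hsumM : ∀ (s : Finset (ℕ × ℕ)) (φ : ℕ × ℕ → SmoothFn d M) (q : M),
        (∑ a ∈ s, φ a).1 q = ∑ a ∈ s, (φ a).1 q := by
      intro s φ q
      simp [Finset.sum_apply]
    simp only [hsumM] at hs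
    rw [hsumU]
    simp only [hterm]
    exact hs
  · ext y
    obtain ⟨F, hF⟩ := exists_restrict_eventuallyEq x f y
    have h1 := value (germ k hF (G := 1) (g := 1) (by rw [restrict_one]))
    rw [(star.unit k hk F).1] at h1
    exact h1.symm
  · ext y
    obtain ⟨F, hF⟩ := exists_restrict_eventuallyEq x f y
    have h1 := value (germ k (F := 1) (f := 1) (by rw [restrict_one]) hF)
    rw [(star.unit k hk F).2] at h1
    exact h1.symm

/-- The bracket omits the constant term of the commutator, which vanishes because $C_0$ is
commutative; the other coefficients are shifted by one and multiplied by $i$. -/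
theorem IsQuantumCanonical.hasScalarCommutator [T2Space M] {P : PoissonTensor d M}
    {star : StarProduct P} {n : ℕ} {x : CoordSystem d M} (h : IsQuantumCanonical star n x)
    (μ ν : Fin d) :
    HasScalarCommutator (star.coeffIn x) (coordFn x.image μ) (coordFn x.image ν)
      (Complex.I * (canonicalMatrix d n μ ν : ℂ)) := by
  have hB := star.isStar_coeffIn x
  unfold HasScalarCommutator
  ext1 m
  rcases m with _ | m
  · rw [map_sub, coeff_starMul_C_C, coeff_starMul_C_C, hB.zero, hB.zero,
      PowerSeries.coeff_zero_X_mul, mul_comm, sub_self]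
  · have hm := congrArg (PowerSeries.coeff m) (h μ ν)
    rw [deformedBracket, PowerSeries.coeff_mk, one_div] at hm
    rw [inv_smul_eq_iff₀ Complex.I_ne_zero] at hm
    rw [PowerSeries.coeff_succ_X_mul]
    refine hm.trans ?_
    rw [PowerSeries.coeff_C, PowerSeries.coeff_C]
    split_ifs
    · rw [map_mul, Algebra.smul_def]
    · exact smul_zero _

end Manifold

end StarProd

end

/-! ### The theorem for the star product in quantum canonical coordinates. -/

theorem theorem1 {d n : ℕ} (hn : 2 * n ≤ d) {M : Type*} [TopologicalSpace M] [T2Space M]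
    [SecondCountableTopology M] [ChartedSpace (StarProd.Eucl d) M]
    [IsManifold (𝓡 d) ∞ M]
    (P : StarProd.PoissonTensor d M) (star : StarProd.StarProduct P)
    (x : StarProd.CoordSystem d M)
    (hcl : StarProd.IsClassicalCanonical P n x)
    (hqu : StarProd.IsQuantumCanonical star n x) :
    ∃ S : ℕ → Module.End ℂ (StarProd.CInf x.image),
      (StarProd.IsFormalDiffSeries S ∧ StarProd.Intertwines n (star.coeffIn x) S ∧
        StarProd.FixesCoords S) ∧
      (∀ T : ℕ → Module.End ℂ (StarProd.CInf x.image),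
        StarProd.IsFormalDiffSeries T → StarProd.Intertwines n (star.coeffIn x) T →
          StarProd.FixesCoords T → T = S) ∧
      (StarProd.Recurrence (star.coeffIn x) S ∧ ∀ k, 1 ≤ k → S k 1 = 0) ∧
      (∀ T : ℕ → Module.End ℂ (StarProd.CInf x.image),
        StarProd.IsFormalDiffSeries T → StarProd.Recurrence (star.coeffIn x) T →
          (∀ k, 1 ≤ k → T k 1 = 0) → T = S) := by
  have hx := StarProd.isCoordinates_pderiv x.image
  have hB := star.isStar_coeffIn x
  have hBl := fun k f => (star.isBidiffOp_coeffIn x k).apply_left_mem f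
  have hBr := fun k g => (star.isBidiffOp_coeffIn x k).flip_apply_mem g
  have hc := hqu.hasScalarCommutator
  have hM := StarProd.isMoyal_moyal x.image n
  have hJ : ∀ i j : Fin d, (StarProd.canonicalMatrix d n i j : ℂ)
      = - (StarProd.canonicalMatrix d n j i : ℂ) := fun i j => by
    rw [StarProd.canonicalMatrix_antisymm]
    push_cast
    rfl
  obtain ⟨S, h0, hS, h1, hr⟩ := hB.exists_recurrence hx hBl hBr hc
  have huniq : ∀ T : ℕ → Module.End ℂ (StarProd.CInf x.image),
      StarProd.IsFormalDiffSeries T → StarProd.Recurrence (star.coeffIn x) T →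
        (∀ k, 1 ≤ k → T k 1 = 0) → T = S := fun T hT hTr hT1 =>
    StarProd.eq_of_recurrenceAt (B := star.coeffIn x) hx h0 hT.1 (fun k _ => hS k)
      (fun k hk => StarProd.isDiffOp_iff_mem.1 (hT.2 k hk)) h1 hT1 (fun k _ => hr k) hTr
  refine ⟨S, ⟨⟨h0, fun k _ => StarProd.isDiffOp_iff_mem.2 (hS k)⟩, ?_, ?_⟩, ?_,
    ⟨fun k _ => hr k, h1⟩, huniq⟩
  · exact hB.opMap_starMul hx hBl hBr hc hM hJ h0 hS h1 hr
  · exact hB.opMap_coord h0 h1 hr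
  -- Uniqueness among intertwiners reduces to uniqueness for the recurrence.
  · intro T hT hTi hTx
    refine huniq T hT (fun k _ => hB.recurrenceAt_of_intertwines hx hM hJ hTi hTx k) ?_
    intro k hk
    have h := congrArg (PowerSeries.coeff k) (hB.opMap_one_of_intertwines hx hM hT.1 hTi)
    rwa [StarProd.coeff_opMap_C, PowerSeries.coeff_C, if_neg (by omega)] at h
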